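/- **Theorem.** Let $G=(V,E)$ be a finite simple undirected graph without isolated vertices, with $n=|V|$ and $m=|E|$. For $C\subseteq V$ let $\mathrm{vol}(C)=\sum_{v\in C}\deg(v)$, let $E(C)$ be the set of edges with both endpoints in $C$, and let $E_{out}(C)$ be the set of edges with exactly one endpoint in $C$. A clustering $\mathcal C=\{C_1,\dots,C_k\}$ of $G$ is a partition of $V$ into any number $k$ of disjoint nonempty sets. Its normalized cut and its normalized modularity are $$\mathrm{NCut}(\mathcal C)=\sum_{i=1}^k\frac{|E_{out}(C_i)|}{\mathrm{vol}(C_i)},\qquad \mathrm{NMod}(\mathcal C)=\sum_{i=1}^k\frac{M(C_i)}{\mathrm{vol}(C_i)},\quad\text{where } M(C)=\frac1m\left(|E(C)|-\frac{\mathrm{vol}(C)^2}{m}\right).$$ There are a constant $T$, a constant $\alpha\in(0,1]$ and a deterministic linear-time algorithm which, given any such graph $G$, computes a clustering $\mathcal C$ of $G$ with the following property: if some clustering $\mathcal C'$ of $G$ into $k$ clusters (for some $k$) satisfies $\mathrm{NCut}(\mathcal C')\le k-T$, then $\mathcal C$ is an $\alpha$-approximate clustering with respect to normalized modularity, i.e.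 $\mathrm{NMod}(\mathcal C)\ge\alpha\cdot\mathrm{NMod}(\mathcal C'')$ for every clustering $\mathcal C''$ of $G$. Here $T$, $\alpha$ and the algorithm do not depend on $G$. The algorithm is a program of a random access machine whose instructions are loading a constant, addition, truncated subtraction, indirect load and store, and branching and looping on comparisons, each at unit cost. For some constant $c$, it makes at most $c\,(n+m+1)$ steps and uses only machine words holding integers between $0$ and $c\,(n+m+1)$. The input is $n$, $m$ and a list of the edges of $G$ in arbitrary order; the output is one label per vertex, with two vertices in the same cluster if and only if their labels are equal. -/

import Mathlib

open Finset

namespace NormMod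

section Clustering

variable {V : Type*} [Fintype V] [DecidableEq V] (G : SimpleGraph V) [DecidableRel G.Adj]

/-- A clustering of the vertex set `V`: a partition of `V` into disjoint nonempty sets. -/
abbrev Clustering (V : Type*) [Fintype V] [DecidableEq V] : Type _ :=
  Finpartition (Finset.univ : Finset V)

/-- The volume of `C`: the sum of the degrees of its vertices. -/
def vol (C : Finset V) : ℕ := ∑ v ∈ C, G.degree v

/-- `E(C)`: the edges with both endpoints in `C`. -/
def innerEdges (C : Finset V) : Finset (Sym2 V) := {e ∈ G.edgeFinset | e.toFinset ⊆ C}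

/-- `E_out(C)`: the edges with exactly one endpoint in `C`. -/
def outEdges (C : Finset V) : Finset (Sym2 V) := {e ∈ G.edgeFinset | #(e.toFinset ∩ C) = 1}

/-- The normalized cut of a clustering. -/
noncomputable def nCut (P : Clustering V) : ℝ :=
  ∑ C ∈ P.parts, (#(outEdges G C) : ℝ) / vol G C

/-- The (unnormalized) modularity of a cluster,
`M(C) = (1/m) (|E(C)| - vol(C)² / m)` where `m` is the number of edges. -/
noncomputable def modularity (C : Finset V) : ℝ :=
  1 / (#G.edgeFinset : ℝ) *
    ((#(innerEdges G C) : ℝ) - (vol G C : ℝ) ^ 2 / (#G.edgeFinset : ℝ))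

/-- The normalized modularity of a clustering. -/
noncomputable def nMod (P : Clustering V) : ℝ :=
  ∑ C ∈ P.parts, modularity G C / vol G C

/-- `P` is an `α`-approximate clustering with respect to the quality metric `f`. -/
def IsApproxClustering (f : Clustering V → ℝ) (α : ℝ) (P : Clustering V) : Prop :=
  ∀ P' : Clustering V, f P ≥ α * f P'

/-- The clustering whose clusters are the sets of vertices carrying the same label. -/
def labelClustering (label : V → ℕ) : Clustering V :=
  haveI : DecidableRel (Setoid.ker label).r :=
    fun a b => inferInstanceAs (Decidable (label a = label b))
  Finpartition.ofSetoid (Setoid.ker label)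

end Clustering

section Machine

/-- Programs of a random access machine with registers `R 0, R 1, …` and memory cells
`M 0, M 1, …`; a program mentions only finitely many registers, and reaches the memory through
indirect addressing. -/
inductive Prog : Type
  /-- do nothing -/
  | skip : Prog
  /-- `R d := k` -/
  | const (d k : ℕ) : Prog
  /-- `R d := R a + R b` -/
  | add (d a b : ℕ) : Prog
  /-- `R d := max (R a - R b) 0` -/
  | sub (d a b : ℕ) : Prog
  /-- `R d := M (R a)` -/
  | load (d a : ℕ) : Prog
  /-- `M (R a) := R b` -/
  | store (a b : ℕ) : Prog
  /-- `p` and then `q` -/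
  | seq (p q : Prog) : Prog
  /-- `if R a < R b then p else q` -/
  | ite (a b : ℕ) (p q : Prog) : Prog
  /-- `while R a < R b do p` -/
  | while (a b : ℕ) (p : Prog) : Prog

/-- The contents of the registers and of the memory. -/
structure State : Type where
  reg : ℕ → ℕ
  mem : ℕ → ℕ

/-- The state `s` with the content of register `d` replaced by `x`. -/
def State.setReg (s : State) (d x : ℕ) : State := { s with reg := Function.update s.reg d x }

/-- The state `s` with the content of memory cell `a` replaced by `x`. -/
def State.setMem (s : State) (a x : ℕ) : State := { s with mem := Function.update s.mem a x }

/-- `Exec B p s t s'`: on a machine whose words hold the numbers `0, …, B`, the program `p` started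
in the state `s` halts in the state `s'` after exactly `t` steps. Every instruction and every
evaluation of a branching or loop condition is one step. A computation that produces a number
exceeding `B` has no run. -/
inductive Exec (B : ℕ) : Prog → State → ℕ → State → Prop
  | skip (s : State) : Exec B .skip s 1 s
  | const (s : State) (d k : ℕ) (hB : k ≤ B) : Exec B (.const d k) s 1 (s.setReg d k)
  | add (s : State) (d a b : ℕ) (hB : s.reg a + s.reg b ≤ B) :
      Exec B (.add d a b) s 1 (s.setReg d (s.reg a + s.reg b))
  | sub (s : State) (d a b : ℕ) (hB : s.reg a - s.reg b ≤ B) :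
      Exec B (.sub d a b) s 1 (s.setReg d (s.reg a - s.reg b))
  | load (s : State) (d a : ℕ) (hB : s.mem (s.reg a) ≤ B) :
      Exec B (.load d a) s 1 (s.setReg d (s.mem (s.reg a)))
  | store (s : State) (a b : ℕ) (hB : s.reg b ≤ B) :
      Exec B (.store a b) s 1 (s.setMem (s.reg a) (s.reg b))
  | seq {p q : Prog} {s s' s'' : State} {t t' : ℕ} (hp : Exec B p s t s')
      (hq : Exec B q s' t' s'') : Exec B (.seq p q) s (t + t') s''
  | ite_true {a b : ℕ} {p q : Prog} {s s' : State} {t : ℕ} (h : s.reg a < s.reg b)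
      (hp : Exec B p s t s') : Exec B (.ite a b p q) s (t + 1) s'
  | ite_false {a b : ℕ} {p q : Prog} {s s' : State} {t : ℕ} (h : ¬ s.reg a < s.reg b)
      (hq : Exec B q s t s') : Exec B (.ite a b p q) s (t + 1) s'
  | while_true {a b : ℕ} {p : Prog} {s s' s'' : State} {t t' : ℕ} (h : s.reg a < s.reg b)
      (hp : Exec B p s t s') (hw : Exec B (.while a b p) s' t' s'') :
      Exec B (.while a b p) s (t + 1 + t') s''
  | while_false {a b : ℕ} {p : Prog} {s : State} (h : ¬ s.reg a < s.reg b) :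
      Exec B (.while a b p) s 1 s

/-- `l` lists every edge of `G` exactly once, in any order, each edge with its endpoints in any
order. -/
def ListsEdges {V : Type*} (G : SimpleGraph V) (l : List (V × V)) : Prop :=
  (l.map fun e => s(e.1, e.2)).Nodup ∧
    ∀ e : Sym2 V, e ∈ (l.map fun e => s(e.1, e.2)) ↔ e ∈ G.edgeSet

/-- The initial state on a graph with vertices `0, …, n - 1` and the edge list
`(u₁, v₁), …, (uₘ, vₘ)`: the memory starts with `n, m, u₁, v₁, …, uₘ, vₘ`, and all other cells and
all registers are `0`. -/
def inputState {n : ℕ} (l : List (Fin n × Fin n)) : State where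
  reg := fun _ => 0
  mem := fun a =>
    (n :: l.length :: l.flatMap fun e => [(e.1 : ℕ), (e.2 : ℕ)]).getD a 0

/-- The clustering that a final state describes: the memory cells directly behind the input, from
number `2 + 2 m` on, hold the labels of the vertices `0, …, n - 1`. -/
def outputClustering (n m : ℕ) (s : State) : Clustering (Fin n) :=
  labelClustering fun v : Fin n => s.mem (2 + 2 * m + v)

end Machine

end NormMod

namespace NormMod

/-! Write I(P) for `innerFrac`, the sum of 2|E(C)|/vol(C) over the clusters of P. Then NCut(P) = k -
I(P) and NMod(P) = (I(P) - 4)/(2m), so the hypothesis says that some clustering has I ≥ T, and the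
task is to approximate the maximum of I. A constant factor for I survives the subtraction of 4 once
I is large enough.

The upper bound is linear programming duality (`innerFrac_le`): if q ≥ 0 satisfies deg(v) q(u) +
deg(u) q(v) ≥ 1 on every edge uv, then summing over the adjacent pairs inside C gives 2|E(C)|/vol(C)
≤ 2 q(C), hence I(P) ≤ 2 q(V) for every P.

The lower bound is a greedy forest of stars. Edges are directed towards the larger degree and
treated by increasing head degree, ties by increasing tail degree. A free tail joins the head's star
as long as the degrees of the leaves sum to at most the degree of the center c. Such a star has
volume at most 2 deg(c), so with s leaves it contributes at least s/deg(c) to I. The weighting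
`starWeight` gives 2s/deg(c) to the center and 1/deg(c) to each leaf, thus 3s/deg(c) to the star. It
is dual feasible (`GreedyInv.step`), because a rejected edge is always paid for by a star that
blocked it. Therefore I(P) ≤ 6 I(stars) for all P (`isApproxClustering_of_greedyInv`).

Degrees are at most n, so two passes of a bucket sort produce the edge order in linear time. The
program is verified with a weakest precondition calculus that also counts steps and bounds words;
`wp_starClustering` identifies its output with the greedy stars. -/

theorem vol_pos {V : Type*} [Fintype V] (G : SimpleGraph V) [DecidableRel G.Adj]
    (hG : ∀ v, 0 < G.degree v) {C : Finset V} (hC : C.Nonempty) : 0 < vol G C :=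
  sum_pos (fun v _ => hG v) hC

/-! ### Cut and modularity through inner edges; linear programming duality. -/

section Graph

variable {V : Type*} [Fintype V] [DecidableEq V] (G : SimpleGraph V) [DecidableRel G.Adj]

/-- The volume of a set counts its inner edges twice and its outgoing edges once. -/
theorem vol_eq (C : Finset V) : vol G C = 2 * #(innerEdges G C) + #(outEdges G C) := by
  -- Double counting of incidences: an edge contributes the number, 0, 1 or 2, of its endpoints in
  -- C.
  have h1 : vol G C = ∑ e ∈ G.edgeFinset, #(e.toFinset ∩ C) := by
    unfold vol
    calc ∑ v ∈ C, G.degree v = ∑ v ∈ C, ∑ e ∈ G.edgeFinset, if v ∈ e then 1 else 0 := by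
          refine sum_congr rfl fun v _ => ?_
          rw [← G.card_incidenceFinset_eq_degree, G.incidenceFinset_eq_filter, card_filter]
      _ = _ := by
          rw [sum_comm]
          refine sum_congr rfl fun e _ => ?_
          rw [← card_filter]
          congr 1
          ext v
          simp [and_comm]
  rw [h1, innerEdges, outEdges, card_filter, card_filter, mul_sum, ← sum_add_distrib]
  refine sum_congr rfl fun e he => ?_
  have h2 : #e.toFinset = 2 :=
    Sym2.card_toFinset_of_not_isDiag _ (G.not_isDiag_of_mem_edgeFinset he)
  by_cases hs : e.toFinset ⊆ C
  · simp [hs, inter_eq_left.2 hs, h2]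
  · have hlt : #(e.toFinset ∩ C) < 2 := by
      rw [← h2]
      exact card_lt_card ⟨inter_subset_left, fun h => hs fun x hx => (mem_inter.1 (h hx)).2⟩
    simp only [hs, if_false]
    split_ifs <;> omega

/-- The sum over the clusters of the fraction of the volume spent on inner edges. -/
noncomputable def innerFrac (P : Clustering V) : ℝ :=
  ∑ C ∈ P.parts, 2 * (#(innerEdges G C) : ℝ) / vol G C

/-- Turns the hypothesis on the normalized cut into a lower bound on `innerFrac`. -/
theorem nCut_eq (hG : ∀ v, 0 < G.degree v) (P : Clustering V) :
    nCut G P = #P.parts - innerFrac G P := by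
  have h : (#P.parts : ℝ) = ∑ C ∈ P.parts, 1 := by simp
  rw [h, nCut, innerFrac, ← sum_sub_distrib]
  refine sum_congr rfl fun C hC => ?_
  have hv : (vol G C : ℝ) ≠ 0 :=
    Nat.cast_ne_zero.2 (vol_pos G hG (P.nonempty_of_mem_parts hC)).ne'
  have := congrArg (Nat.cast (R := ℝ)) (vol_eq G C)
  push_cast at this
  field_simp
  linarith

theorem sum_vol_parts (P : Clustering V) : ∑ C ∈ P.parts, vol G C = 2 * #G.edgeFinset := by
  rw [← G.sum_degrees_eq_twice_card_edges]
  unfold vol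
  conv_rhs => rw [← P.biUnion_parts]
  rw [sum_biUnion P.disjoint]
  rfl

/-- The quadratic terms vol(C)²/m become linear after division by vol(C), so their total does not
depend on the clustering. -/
theorem nMod_eq (hG : ∀ v, 0 < G.degree v) (P : Clustering V) :
    nMod G P = (innerFrac G P - 4) / (2 * #G.edgeFinset) := by
  -- Without edges both sides are 0, since division by 0 gives 0.
  by_cases hm : (#G.edgeFinset : ℝ) = 0
  · simp [nMod, modularity, hm]
  have h4 : (4 : ℝ) = 2 / #G.edgeFinset * ∑ C ∈ P.parts, (vol G C : ℝ) := by
    have := congrArg (Nat.cast (R := ℝ)) (sum_vol_parts G P)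
    push_cast at this
    rw [this]
    field_simp
    norm_num
  rw [h4, nMod, innerFrac, mul_sum, ← sum_sub_distrib, sum_div]
  refine sum_congr rfl fun C hC => ?_
  have hv : (vol G C : ℝ) ≠ 0 :=
    Nat.cast_ne_zero.2 (vol_pos G hG (P.nonempty_of_mem_parts hC)).ne'
  rw [modularity]
  field_simp

/-- The handshake lemma for the graph on V that keeps only the edges inside C. -/
theorem two_mul_card_innerEdges (C : Finset V) :
    2 * #(innerEdges G C) = ∑ v ∈ C, ∑ w ∈ C, if G.Adj v w then 1 else 0 := by
  let H : SimpleGraph V :=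
    { Adj := fun v w => G.Adj v w ∧ v ∈ C ∧ w ∈ C
      symm := ⟨fun v w h => ⟨h.1.symm, h.2.2, h.2.1⟩⟩
      loopless := ⟨fun v h => G.loopless.irrefl v h.1⟩ }
  have : DecidableRel H.Adj := fun v w =>
    inferInstanceAs (Decidable (G.Adj v w ∧ v ∈ C ∧ w ∈ C))
  have hE : H.edgeFinset = innerEdges G C := by
    ext e
    induction e with
    | _ v w =>
      simp [innerEdges, H, Sym2.toFinset_mk_eq, insert_subset_iff]
  rw [← hE, ← H.sum_degrees_eq_twice_card_edges, ← sum_subset (subset_univ C)]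
  · refine sum_congr rfl fun v hv => ?_
    rw [← card_filter, ← H.card_neighborFinset_eq_degree]
    congr 1
    ext w
    simp [H, hv, and_comm]
  · intro v _ hv
    rw [← H.card_neighborFinset_eq_degree, card_eq_zero]
    ext w
    simp [H, hv]

/-- Weak duality: a feasible vertex weighting bounds every clustering. -/
theorem innerFrac_le (hG : ∀ v, 0 < G.degree v) (q : V → ℝ) (hq : ∀ v, 0 ≤ q v)
    (hE : ∀ u v, G.Adj u v → 1 ≤ G.degree v * q u + G.degree u * q v) (P : Clustering V) :
    innerFrac G P ≤ 2 * ∑ v, q v := by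
  -- Sum the edge constraint over ordered adjacent pairs in C. Extending the sum to all pairs only
  -- adds nonnegative terms and makes it factor as 2 q(C) vol(C).
  have key : ∀ C ∈ P.parts, 2 * (#(innerEdges G C) : ℝ) / vol G C ≤ 2 * ∑ v ∈ C, q v := by
    intro C hC
    have hv : (0 : ℝ) < vol G C :=
      Nat.cast_pos.2 (vol_pos G hG (P.nonempty_of_mem_parts hC))
    rw [div_le_iff₀ hv]
    have h1 := congrArg (Nat.cast (R := ℝ)) (two_mul_card_innerEdges G C)
    push_cast at h1
    rw [h1]
    have h2 : ∑ v ∈ C, ∑ w ∈ C, (G.degree w : ℝ) * q v = (∑ v ∈ C, q v) * vol G C := by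
      rw [vol, Nat.cast_sum, sum_mul_sum]
      exact sum_congr rfl fun v _ => sum_congr rfl fun w _ => mul_comm _ _
    have h3 : ∑ v ∈ C, ∑ w ∈ C, (G.degree v : ℝ) * q w = (∑ v ∈ C, q v) * vol G C := by
      rw [sum_comm, h2]
    calc ∑ v ∈ C, ∑ w ∈ C, (if G.Adj v w then (1 : ℝ) else 0)
        ≤ ∑ v ∈ C, ∑ w ∈ C, ((G.degree w : ℝ) * q v + G.degree v * q w) := by
          refine sum_le_sum fun v _ => sum_le_sum fun w _ => ?_
          split_ifs with h
          · exact hE v w h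
          · have := hq v
            have := hq w
            positivity
      _ = 2 * (∑ v ∈ C, q v) * vol G C := by
          simp only [sum_add_distrib]
          rw [h2, h3]
          ring
  refine (sum_le_sum key).trans_eq ?_
  rw [← mul_sum]
  congr 1
  conv_rhs => rw [← P.biUnion_parts]
  rw [sum_biUnion P.disjoint]
  rfl

end Graph

/-! ### The greedy forest of stars and its dual weighting. -/

section Stars

variable {V : Type*} [Fintype V] [DecidableEq V]

/-- The vertices that `lab` maps to `v`, without `v` itself. -/
def children (lab : V → V) (v : V) : Finset V := {u | lab u = v ∧ u ≠ v}

theorem mem_children {lab : V → V} {u v : V} : u ∈ children lab v ↔ lab u = v ∧ u ≠ v := by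
  simp [children]

/-- The vertex weighting read off from a forest of stars. -/
noncomputable def starWeight (d : V → ℕ) (lab : V → V) (u : V) : ℝ :=
  if lab u = u then 2 * #(children lab u) / d u else 1 / d (lab u)

theorem starWeight_nonneg (d : V → ℕ) (lab : V → V) (u : V) : 0 ≤ starWeight d lab u := by
  unfold starWeight
  split_ifs <;> positivity

/-- One step of the greedy algorithm, on the edge `e`: the vertex `e.1` becomes a leaf of the star
with center `e.2` if it is still free and the load of the center permits. -/
def greedyStep (d : V → ℕ) (σ : (V → ℕ) × (V → V)) (e : V × V) : (V → ℕ) × (V → V) :=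
  if σ.1 e.1 = 0 ∧ σ.1 e.2 + d e.1 ≤ d e.2 then
    (Function.update (Function.update σ.1 e.1 (d e.1)) e.2 (σ.1 e.2 + d e.1),
      Function.update σ.2 e.1 e.2)
  else σ

/-- The order in which the greedy algorithm treats the edges. -/
def EdgeLE (d : V → ℕ) (e e' : V × V) : Prop :=
  d e.2 < d e'.2 ∨ (d e.2 = d e'.2 ∧ d e.1 ≤ d e'.1)

/-- What holds after the edges in `es` have been treated. -/
structure GreedyInv (d : V → ℕ) (es : List (V × V)) (σ : (V → ℕ) × (V → V)) : Prop where
  leaf : ∀ u, σ.2 u ≠ u → σ.1 u = d u ∧ σ.2 (σ.2 u) = σ.2 u ∧ (u, σ.2 u) ∈ es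
  root : ∀ v, σ.2 v = v → σ.1 v = ∑ u ∈ children σ.2 v, d u ∧ σ.1 v ≤ d v
  weight : ∀ e ∈ es, 1 ≤ d e.2 * starWeight d σ.2 e.1 + d e.1 * starWeight d σ.2 e.2

theorem GreedyInv.nil (d : V → ℕ) : GreedyInv d [] (fun _ => 0, id) where
  leaf := by simp
  root := by
    intro v _
    have : children (id : V → V) v = ∅ := by
      ext u
      simp [mem_children]
    simp [this]
  weight := by simp

/-- Weights never decrease, so edges treated earlier stay covered. An accepted edge is covered by
its new leaf alone; a rejected one by its tail if that was already in use, and otherwise by its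
head, which had no room left. -/
theorem GreedyInv.step {d : V → ℕ} (hd : ∀ v, 0 < d v) {es : List (V × V)}
    {σ : (V → ℕ) × (V → V)} (h : GreedyInv d es σ) {e : V × V} (hne : e.1 ≠ e.2)
    (hle : d e.1 ≤ d e.2) (hes : ∀ e' ∈ es, d e'.1 ≤ d e'.2 ∧ EdgeLE d e' e) :
    GreedyInv d (es ++ [e]) (greedyStep d σ e) := by
  obtain ⟨u, v⟩ := e
  obtain ⟨load, lab⟩ := σ
  obtain ⟨hleaf, hroot, hweight⟩ := h
  simp only at hne hle hleaf hroot hweight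
  have hdr : ∀ x, (0 : ℝ) < d x := fun x => Nat.cast_pos.2 (hd x)
  by_cases hacc : load u = 0 ∧ load v + d u ≤ d v
  · obtain ⟨h0, hv⟩ := hacc
    -- A leaf carries its full degree, which is positive, as load. Hence a free tail and a head with
    -- room are both roots, and the tail has no leaves of its own.
    have hlu : lab u = u := by
      by_contra hc
      have := (hleaf u hc).1
      have := hd u
      omega
    have hlv : lab v = v := by
      by_contra hc
      have := (hleaf v hc).1
      have := hd u
      omega
    have hcu : children lab u = ∅ := by
      by_contra hc
      obtain ⟨w, hw⟩ := nonempty_iff_ne_empty.2 hc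
      have h1 := (hroot u hlu).1
      have h2 := single_le_sum (f := d) (fun _ _ => Nat.zero_le _) hw
      have := hd w
      omega
    have hnu : ∀ w, w ≠ u → lab w ≠ u := by
      intro w hw hc
      have : w ∈ children lab u := mem_children.2 ⟨hc, hw⟩
      simp [hcu] at this
    have hch : ∀ x, children (Function.update lab u v) x =
        if x = v then insert u (children lab v) else children lab x := by
      intro x
      ext w
      by_cases hw : w = u
      · subst hw
        by_cases hx : x = v
        · subst hx
          simp [mem_children, hne]
        · simp [mem_children, hx, Ne.symm hx, hlu]
      · by_cases hx : x = v
        · subst hx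
          simp [mem_children, hw]
        · simp [mem_children, hx, hw]
    have hucv : u ∉ children lab v := by simp [mem_children, hlu, hne]
    -- Only u changes its role, and its weight was 0; the center v gains a leaf.
    have hmono : ∀ x, starWeight d lab x ≤ starWeight d (Function.update lab u v) x := by
      intro x
      by_cases hx : x = u
      · subst hx
        have : starWeight d lab x = 0 := by simp [starWeight, hlu, hcu]
        rw [this]
        exact starWeight_nonneg _ _ _
      · unfold starWeight
        rw [Function.update_of_ne hx]
        split_ifs with hl
        · have : #(children lab x) ≤ #(children (Function.update lab u v) x) := by
            rw [hch]
            split_ifs with hxv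
            · subst hxv
              exact card_le_card (subset_insert _ _)
            · exact le_rfl
          have h2 : (#(children lab x) : ℝ) ≤ #(children (Function.update lab u v) x) := by
            exact_mod_cast this
          gcongr
        · exact le_rfl
    rw [greedyStep, if_pos ⟨h0, hv⟩]
    refine ⟨?_, ?_, ?_⟩
    · intro w hw
      simp only at hw ⊢
      by_cases hwu : w = u
      · subst hwu
        simp [hne, hne.symm, hlv]
      · rw [Function.update_of_ne hwu] at hw ⊢
        have hwv : w ≠ v := fun hc => hw (by rw [hc, hlv])
        obtain ⟨h1, h2, h3⟩ := hleaf w hw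
        refine ⟨?_, ?_, ?_⟩
        · rw [Function.update_of_ne hwv, Function.update_of_ne hwu, h1]
        · rw [Function.update_of_ne (hnu w hwu), h2]
        · simp [h3]
    · intro w hw
      simp only at hw ⊢
      have hwu : w ≠ u := by
        intro hc
        subst hc
        simp [hne.symm] at hw
      rw [Function.update_of_ne hwu] at hw
      rw [hch]
      obtain ⟨h1, h2⟩ := hroot w hw
      by_cases hwv : w = v
      · subst hwv
        simp only [Function.update_self, if_true, sum_insert hucv]
        omega
      · rw [Function.update_of_ne hwv, Function.update_of_ne hwu, if_neg hwv]
        exact ⟨h1, h2⟩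
    · intro e' he'
      rcases List.mem_append.1 he' with he' | he'
      · refine (hweight e' he').trans ?_
        have := hmono e'.1
        have := hmono e'.2
        gcongr
      · rw [List.mem_singleton] at he'
        subst he'
        simp only
        have h1 : starWeight d (Function.update lab u v) u = 1 / d v := by
          simp [starWeight, hne.symm]
        rw [h1, mul_one_div_cancel (hdr v).ne']
        have := starWeight_nonneg d (Function.update lab u v) v
        have := hdr u
        nlinarith [mul_nonneg (hdr u).le (starWeight_nonneg d (Function.update lab u v) v)]
  · rw [greedyStep, if_neg hacc]
    refine ⟨fun w hw => ?_, hroot, ?_⟩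
    · obtain ⟨h1, h2, h3⟩ := hleaf w hw
      exact ⟨h1, h2, List.mem_append_left _ h3⟩
    · intro e' he'
      rcases List.mem_append.1 he' with he' | he'
      · exact hweight e' he'
      rw [List.mem_singleton] at he'
      subst he'
      simp only
      have n1 := mul_nonneg (hdr v).le (starWeight_nonneg d lab u)
      have n2 := mul_nonneg (hdr u).le (starWeight_nonneg d lab v)
      have hler : (d u : ℝ) ≤ d v := by exact_mod_cast hle
      by_cases h0 : load u = 0
      · have hv : d v < load v + d u := by
          by_contra hc
          exact hacc ⟨h0, not_lt.1 hc⟩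
        suffices 1 ≤ d u * starWeight d lab v by linarith
        by_cases hlv : lab v = v
        · obtain ⟨h1, h2⟩ := hroot v hlv
          -- The leaves of v came from earlier edges with the same head v, so the tie-break makes
          -- their degrees at most d u.
          have h3 : ∑ w ∈ children lab v, d w ≤ #(children lab v) * d u := by
            rw [← smul_eq_mul]
            refine sum_le_card_nsmul _ _ _ fun w hw => ?_
            obtain ⟨hw1, hw2⟩ := mem_children.1 hw
            have hm := (hleaf w (by rw [hw1]; exact hw2.symm)).2.2
            rw [hw1] at hm
            rcases (hes _ hm).2 with h | h
            · exact absurd h (lt_irrefl _)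
            · exact h.2
          have h4 : 1 ≤ #(children lab v) := by
            by_contra hc
            have : #(children lab v) = 0 := by omega
            rw [this] at h3
            omega
          -- With s ≥ 1 leaves, d v < load v + d u ≤ (s + 1) d u ≤ 2 s d u. This is where the factor
          -- 2 in the weight of a center comes from.
          have h5 : d v ≤ 2 * #(children lab v) * d u := by nlinarith
          have h6 : (d v : ℝ) ≤ 2 * #(children lab v) * d u := by exact_mod_cast h5
          rw [starWeight, if_pos hlv, ← mul_div_assoc, le_div_iff₀ (hdr v)]
          linarith
        · obtain ⟨h1, h2, h3⟩ := hleaf v hlv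
          obtain ⟨h4, h5⟩ := hes _ h3
          simp only [EdgeLE] at h4 h5
          -- The edge from v to its center came earlier: its direction and the sorting force equal
          -- head degrees, and then the tie-break compares the tails v and u.
          have h6 : d (lab v) = d v ∧ d v ≤ d u := by omega
          rw [starWeight, if_neg hlv, h6.1, mul_one_div, le_div_iff₀ (hdr v), one_mul]
          exact_mod_cast h6.2
      · suffices 1 ≤ d v * starWeight d lab u by linarith
        by_cases hlu : lab u = u
        · obtain ⟨h1, h2⟩ := hroot u hlu
          have h4 : 1 ≤ #(children lab u) := by
            by_contra hc
            have : children lab u = ∅ := card_eq_zero.1 (by omega)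
            rw [this] at h1
            simp at h1
            omega
          have h5 : (1 : ℝ) ≤ #(children lab u) := by exact_mod_cast h4
          -- One leaf at u is enough, because d u ≤ d v.
          rw [starWeight, if_pos hlu, ← mul_div_assoc, le_div_iff₀ (hdr u)]
          nlinarith [hdr v]
        · obtain ⟨h1, h2, h3⟩ := hleaf u hlu
          obtain ⟨h4, h5⟩ := hes _ h3
          simp only [EdgeLE] at h4 h5
          have h6 : d (lab u) ≤ d v := by omega
          rw [starWeight, if_neg hlu, mul_one_div, le_div_iff₀ (hdr _), one_mul]
          exact_mod_cast h6

theorem greedyInv_foldl {d : V → ℕ} (hd : ∀ v, 0 < d v) {es : List (V × V)}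
    (hes : ∀ e ∈ es, e.1 ≠ e.2 ∧ d e.1 ≤ d e.2) (hs : es.Pairwise (EdgeLE d)) :
    GreedyInv d es (es.foldl (greedyStep d) (fun _ => 0, id)) := by
  induction es using List.reverseRecOn with
  | nil => exact GreedyInv.nil d
  | append_singleton es e ih =>
    rw [List.foldl_append, List.foldl_cons, List.foldl_nil]
    rw [List.pairwise_append] at hs
    have he := hes e (by simp)
    refine (ih (fun e' h' => hes e' (by simp [h'])) hs.1).step hd he.1 he.2 fun e' h' => ?_
    exact ⟨(hes e' (by simp [h'])).2, hs.2.2 e' h' e (by simp)⟩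

variable (G : SimpleGraph V) [DecidableRel G.Adj]

theorem exists_of_mem_labelClustering_parts {label : V → ℕ} {C : Finset V}
    (hC : C ∈ (labelClustering label).parts) : ∃ v, ∀ u, u ∈ C ↔ label u = label v := by
  obtain ⟨v, hv⟩ := (labelClustering label).nonempty_of_mem_parts hC
  refine ⟨v, fun u => ?_⟩
  rw [← (labelClustering label).part_eq_of_mem hC hv]
  let : DecidableRel (Setoid.ker label).r :=
    fun a b => inferInstanceAs (Decidable (label a = label b))
  have h : u ∈ (Finpartition.ofSetoid (Setoid.ker label)).part v ↔ label v = label u :=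
    Finpartition.mem_part_ofSetoid_iff_rel
  exact h.trans eq_comm

/-- The clustering into stars is worth a third of the weighting read off from it. -/
theorem sum_starWeight_le (hG : ∀ v, 0 < G.degree v) {es : List (V × V)}
    (hes : ∀ e ∈ es, G.Adj e.1 e.2)
    {σ : (V → ℕ) × (V → V)} (h : GreedyInv (fun v => G.degree v) es σ)
    {label : V → ℕ} (hl : ∀ u v, label u = label v ↔ σ.2 u = σ.2 v) :
    ∑ v, starWeight (fun v => G.degree v) σ.2 v ≤ 3 * innerFrac G (labelClustering label) := by
  obtain ⟨load, lab⟩ := σ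
  obtain ⟨hleaf, hroot, -⟩ := h
  simp only at hleaf hroot hl ⊢
  conv_lhs => rw [← (labelClustering label).biUnion_parts]
  rw [sum_biUnion (labelClustering label).disjoint, innerFrac, mul_sum]
  refine sum_le_sum fun C hC => ?_
  obtain ⟨v, hv⟩ := exists_of_mem_labelClustering_parts hC
  have hvol := vol_pos G hG ((labelClustering label).nonempty_of_mem_parts hC)
  obtain ⟨c, hcv⟩ : ∃ c, lab v = c := ⟨_, rfl⟩
  have hcc : lab c = c := by
    by_cases h : lab v = v
    · rw [← hcv, h, h]
    · rw [← hcv]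
      exact (hleaf v h).2.1
  -- Each cluster is a star: a center together with its leaves.
  have hCc : C = insert c (children lab c) := by
    ext u
    rw [hv, hl, hcv, mem_insert, mem_children]
    by_cases hu : u = c
    · simp [hu, hcc]
    · simp [hu]
  have hcn : c ∉ children lab c := by simp [mem_children]
  have hd : (0 : ℝ) < G.degree c := Nat.cast_pos.2 (hG c)
  have hsum : ∑ u ∈ C, starWeight (fun v => G.degree v) lab u =
      3 * (#(children lab c) / G.degree c) := by
    rw [hCc, sum_insert hcn]
    have : ∀ u ∈ children lab c,
        starWeight (fun v => G.degree v) lab u = 1 / (G.degree c : ℝ) := by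
      intro u hu
      obtain ⟨h1, h2⟩ := mem_children.1 hu
      rw [starWeight, if_neg (by rw [h1]; exact h2.symm), h1]
    rw [sum_congr rfl this, sum_const, nsmul_eq_mul, starWeight, if_pos hcc]
    ring
  have hinner : #(children lab c) ≤ #(innerEdges G C) := by
    refine card_le_card_of_injOn (fun u => s(u, c)) ?_ ?_
    · intro u hu
      obtain ⟨h1, h2⟩ := mem_children.1 hu
      have h3 := hes _ (hleaf u (by rw [h1]; exact h2.symm)).2.2
      rw [h1] at h3
      have h4 : G.Adj u c := h3
      have h5 : u ∈ children lab c := hu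
      simp [innerEdges, h4, hCc, Sym2.toFinset_mk_eq, insert_subset_iff, h5]
    · intro u hu w _ huw
      have hu2 := (mem_children.1 hu).2
      simpa [hu2] using huw
  -- The load of the center, at most its degree, is the volume of the leaves.
  have hvol2 : vol G C ≤ 2 * G.degree c := by
    obtain ⟨h1, h2⟩ := hroot c hcc
    rw [vol, hCc, sum_insert hcn]
    omega
  have h1 : (#(children lab c) : ℝ) ≤ #(innerEdges G C) := by exact_mod_cast hinner
  have h2 : (vol G C : ℝ) ≤ 2 * G.degree c := by exact_mod_cast hvol2
  have h3 : (0 : ℝ) < vol G C := by exact_mod_cast hvol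
  rw [id, hsum]
  refine mul_le_mul_of_nonneg_left ?_ (by norm_num)
  rw [div_le_div_iff₀ hd h3]
  have h0 : (0 : ℝ) ≤ #(children lab c) := Nat.cast_nonneg _
  nlinarith [mul_le_mul h1 h2 h3.le (h0.trans h1)]

/-- Clustering by the stars of the greedy algorithm is a constant factor approximation as soon as
some clustering has a small normalized cut. -/
theorem isApproxClustering_of_greedyInv (hG : ∀ v, 0 < G.degree v) {es : List (V × V)}
    (hes : ∀ e ∈ es, G.Adj e.1 e.2) (hcover : ∀ u v, G.Adj u v → (u, v) ∈ es ∨ (v, u) ∈ es)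
    {σ : (V → ℕ) × (V → V)} (h : GreedyInv (fun v => G.degree v) es σ)
    {label : V → ℕ} (hl : ∀ u v, label u = label v ↔ σ.2 u = σ.2 v)
    (hP : ∃ P : Clustering V, nCut G P ≤ (#P.parts : ℝ) - 48) :
    IsApproxClustering (nMod G) (1 / 12) (labelClustering label) := by
  have hle : ∀ P, innerFrac G P ≤ 6 * innerFrac G (labelClustering label) := by
    intro P
    have hE : ∀ u v, G.Adj u v → (1 : ℝ) ≤
        G.degree v * starWeight (fun v => G.degree v) σ.2 u +
          G.degree u * starWeight (fun v => G.degree v) σ.2 v := by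
      intro u v huv
      rcases hcover u v huv with he | he
      · exact h.weight (u, v) he
      · have := h.weight (v, u) he
        simp only at this
        linarith
    have h1 := innerFrac_le G hG _ (starWeight_nonneg _ _) hE P
    linarith [sum_starWeight_le G hG hes h hl]
  intro P'
  obtain ⟨P, hP⟩ := hP
  rw [nCut_eq G hG] at hP
  have h1 := hle P
  have h2 := hle P'
  rw [nMod_eq G hG, nMod_eq G hG, ge_iff_le, ← mul_div_assoc]
  refine div_le_div_of_nonneg_right ?_ (by positivity)
  -- With I the value of the stars, 48 ≤ 6 I gives I ≥ 8, so I - 4 ≥ I/2, and I/2 is at least a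
  -- twelfth of any other value.
  linarith

end Stars

/-! ### Weakest preconditions -/

/-- `p` started in `s` halts, after `t` steps in a state `s'` such that `Q t s'`. -/
def WP (B : ℕ) (p : Prog) (s : State) (Q : ℕ → State → Prop) : Prop :=
  ∃ t s', Exec B p s t s' ∧ Q t s'

theorem WP.mono {B : ℕ} {p : Prog} {s : State} {Q Q' : ℕ → State → Prop} (h : WP B p s Q)
    (hQ : ∀ t s', Q t s' → Q' t s') : WP B p s Q' :=
  let ⟨t, s', he, hq⟩ := h
  ⟨t, s', he, hQ t s' hq⟩

theorem wp_skip {B : ℕ} {s : State} {Q : ℕ → State → Prop} (h : Q 1 s) : WP B .skip s Q :=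
  ⟨1, s, .skip s, h⟩

theorem wp_seq {B : ℕ} {p q : Prog} {s : State} {Q : ℕ → State → Prop}
    (h : WP B p s fun t s' => WP B q s' fun t' s'' => Q (t + t') s'') : WP B (.seq p q) s Q :=
  let ⟨_, _, hp, _, _, hq, h⟩ := h
  ⟨_, _, .seq hp hq, h⟩

theorem wp_ite {B a b : ℕ} {p q : Prog} {s : State} {Q : ℕ → State → Prop}
    (h₁ : s.reg a < s.reg b → WP B p s fun t s' => Q (t + 1) s')
    (h₂ : ¬ s.reg a < s.reg b → WP B q s fun t s' => Q (t + 1) s') :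
    WP B (.ite a b p q) s Q := by
  by_cases h : s.reg a < s.reg b
  · obtain ⟨t, s', hp, hQ⟩ := h₁ h
    exact ⟨_, _, .ite_true h hp, hQ⟩
  · obtain ⟨t, s', hp, hQ⟩ := h₂ h
    exact ⟨_, _, .ite_false h hp, hQ⟩

/-- A loop that passes through the invariants `I 0, …, I N`, with `τ k` steps in round `k`. -/
theorem wp_while {B a b : ℕ} {p : Prog} {Q : ℕ → State → Prop} {I : ℕ → State → Prop} {N : ℕ}
    {τ : ℕ → ℕ}
    (hbody : ∀ k < N, ∀ s, I k s →
      s.reg a < s.reg b ∧ WP B p s fun t s' => t ≤ τ k ∧ I (k + 1) s')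
    (hend : ∀ s, I N s → ¬ s.reg a < s.reg b) {s : State} (h0 : I 0 s)
    (hQ : ∀ t s', t ≤ ∑ k ∈ range N, (τ k + 1) + 1 → I N s' → Q t s') :
    WP B (.while a b p) s Q := by
  -- Induction on the number j of remaining rounds.
  suffices H : ∀ j k, k + j = N → ∀ s, I k s → ∃ t s', Exec B (.while a b p) s t s' ∧
      t ≤ ∑ i ∈ Ico k N, (τ i + 1) + 1 ∧ I N s' by
    obtain ⟨t, s', he, ht, hI⟩ := H N 0 (by omega) s h0
    exact ⟨t, s', he, hQ t s' (by rwa [range_eq_Ico]) hI⟩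
  intro j
  induction j with
  | zero =>
    intro k hk s hs
    obtain rfl : k = N := by omega
    exact ⟨1, s, .while_false (hend s hs), by simp, hs⟩
  | succ j ih =>
    intro k hk s hs
    obtain ⟨hlt, t, s', hp, ht, hI⟩ := hbody k (by omega) s hs
    obtain ⟨t', s'', hw, ht', hI'⟩ := ih (k + 1) (by omega) s' hI
    refine ⟨_, _, .while_true hlt hp hw, ?_, hI'⟩
    rw [sum_eq_sum_Ico_succ_bot (by omega)]
    omega

/-! ### Memory layout -/

section Layout

variable {n : ℕ}

/-- The size of an array in the working memory. -/
def width (l : List (Fin n × Fin n)) : ℕ := n + l.length + 1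

/-- The address of entry `i` of array `r`. -/
def cell (l : List (Fin n × Fin n)) (r i : ℕ) : ℕ := 2 + 2 * l.length + r * width l + i

/-- The arrays in the memory of a state. -/
def arr (l : List (Fin n × Fin n)) (s : State) (r i : ℕ) : ℕ :=
  if r < 9 ∧ i < width l then s.mem (cell l r i) else 0

/-- Array contents `A` with entry `i` of array `r` replaced by `x`. -/
def upd (A : ℕ → ℕ → ℕ) (r i x : ℕ) : ℕ → ℕ → ℕ :=
  Function.update A r (Function.update (A r) i x)

@[simp]
theorem upd_self (A : ℕ → ℕ → ℕ) (r i x : ℕ) : upd A r i x r = Function.update (A r) i x := by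
  simp [upd]

theorem upd_of_ne (A : ℕ → ℕ → ℕ) {r r' : ℕ} (i x : ℕ) (h : r' ≠ r) : upd A r i x r' = A r' := by
  simp [upd, h]

/-- The part of the state that stays the same after the set-up: some constants, the base addresses
of the arrays, and the input. -/
structure Ctx (B : ℕ) (l : List (Fin n × Fin n)) (s : State) : Prop where
  bound : 20 * width l ≤ B
  zero : s.reg 0 = 0
  one : s.reg 1 = 1
  size : s.reg 2 = n
  length : s.reg 3 = l.length
  width : s.reg 4 = width l
  base : ∀ r < 9, s.reg (5 + r) = cell l r 0
  fst : ∀ i : Fin l.length, s.mem (2 * i + 2) = (l.get i).1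
  snd : ∀ i : Fin l.length, s.mem (2 * i + 3) = (l.get i).2

variable {l : List (Fin n × Fin n)} {B : ℕ} {s : State} {Q : ℕ → State → Prop}

theorem width_eq : NormMod.width l = n + l.length + 1 := rfl

theorem cell_le {r i : ℕ} (hr : r < 9) (hi : i < width l) : cell l r i ≤ 12 * width l := by
  have : r * width l ≤ 8 * width l := Nat.mul_le_mul_right _ (by omega)
  have := width_eq (l := l)
  unfold cell
  omega

theorem cell_inj {r r' i i' : ℕ} (hi : i < width l) (hi' : i' < width l)
    (h : cell l r i = cell l r' i') : r = r' ∧ i = i' := by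
  unfold cell at h
  have h1 : r * width l + i = r' * width l + i' := by omega
  -- Quotient and remainder modulo the width recover the array and the index.
  have h2 := congrArg (· / width l) h1
  have h0 : 0 < width l := by omega
  simp only [mul_comm _ (width l), Nat.mul_add_div h0, Nat.div_eq_of_lt hi,
    Nat.div_eq_of_lt hi'] at h2
  have h3 : r = r' := by omega
  subst h3
  exact ⟨rfl, by omega⟩

@[simp]
theorem arr_setReg (d x : ℕ) : arr l (s.setReg d x) = arr l s := rfl

theorem arr_setMem {r i : ℕ} (hr : r < 9) (hi : i < width l) (x : ℕ) :
    arr l (s.setMem (cell l r i) x) = upd (arr l s) r i x := by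
  funext r' i'
  by_cases h : r' = r
  · subst h
    rw [upd_self]
    by_cases h' : i' = i
    · subst h'
      simp [arr, hr, hi, State.setMem]
    · rw [Function.update_of_ne h']
      unfold arr
      split_ifs with hv
      · refine Function.update_of_ne (fun hc => h' (cell_inj hv.2 hi hc).2) _ _
      · rfl
  · rw [upd_of_ne _ _ _ h]
    unfold arr
    split_ifs with hv
    · refine Function.update_of_ne (fun hc => h (cell_inj hv.2 hi hc).1) _ _
    · rfl

theorem Ctx.setReg (h : Ctx B l s) {d : ℕ} (hd : 14 ≤ d) (x : ℕ) : Ctx B l (s.setReg d x) := by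
  have hr : ∀ r < 14, (s.setReg d x).reg r = s.reg r := fun r hr =>
    Function.update_of_ne (by omega) _ _
  constructor
  · exact h.bound
  · rw [hr _ (by omega), h.zero]
  · rw [hr _ (by omega), h.one]
  · rw [hr _ (by omega), h.size]
  · rw [hr _ (by omega), h.length]
  · rw [hr _ (by omega), h.width]
  · intro r hr'
    rw [hr _ (by omega), h.base r hr']
  · exact h.fst
  · exact h.snd

theorem Ctx.setMem (h : Ctx B l s) (r i x : ℕ) : Ctx B l (s.setMem (cell l r i) x) := by
  have hr : ∀ a < 2 + 2 * l.length, (s.setMem (cell l r i) x).mem a = s.mem a := by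
    intro a ha
    exact Function.update_of_ne (by unfold cell; omega) _ _
  constructor
  · exact h.bound
  · exact h.zero
  · exact h.one
  · exact h.size
  · exact h.length
  · exact h.width
  · exact h.base
  · intro i
    rw [hr _ (by omega), h.fst]
  · intro i
    rw [hr _ (by omega), h.snd]

theorem wp_const (h : Ctx B l s) {d k : ℕ} (hd : 14 ≤ d) (hk : k ≤ B)
    (hQ : ∀ s', Ctx B l s' → arr l s' = arr l s → s'.reg = Function.update s.reg d k → Q 1 s') :
    WP B (.const d k) s Q :=
  ⟨_, _, .const s d k hk, hQ _ (h.setReg hd _) rfl rfl⟩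

theorem wp_add (h : Ctx B l s) {d a b : ℕ} (hd : 14 ≤ d) (hk : s.reg a + s.reg b ≤ B)
    (hQ : ∀ s', Ctx B l s' → arr l s' = arr l s →
      s'.reg = Function.update s.reg d (s.reg a + s.reg b) → Q 1 s') :
    WP B (.add d a b) s Q :=
  ⟨_, _, .add s d a b hk, hQ _ (h.setReg hd _) rfl rfl⟩

theorem wp_sub (h : Ctx B l s) {d a b : ℕ} (hd : 14 ≤ d) (hk : s.reg a ≤ B)
    (hQ : ∀ s', Ctx B l s' → arr l s' = arr l s →
      s'.reg = Function.update s.reg d (s.reg a - s.reg b) → Q 1 s') :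
    WP B (.sub d a b) s Q :=
  ⟨_, _, .sub s d a b ((Nat.sub_le _ _).trans hk), hQ _ (h.setReg hd _) rfl rfl⟩

/-- Load entry `R i` of array `r` into register `d`. -/
def rd (r d i : ℕ) : Prog := .seq (.add 14 (5 + r) i) (.load d 14)

/-- Store register `b` into entry `R i` of array `r`. -/
def wr (r i b : ℕ) : Prog := .seq (.add 14 (5 + r) i) (.store 14 b)

theorem wp_rd (h : Ctx B l s) {r d i : ℕ} (hr : r < 9) (hd : 15 ≤ d) (hi : s.reg i < width l)
    (hB : arr l s r (s.reg i) ≤ B)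
    (hQ : ∀ s', Ctx B l s' → arr l s' = arr l s → s'.reg d = arr l s r (s.reg i) →
      (∀ a, a ≠ 14 → a ≠ d → s'.reg a = s.reg a) → Q 2 s') :
    WP B (rd r d i) s Q := by
  have hb := h.base r hr
  have hc : s.reg (5 + r) + s.reg i = cell l r (s.reg i) := by
    rw [hb]
    simp [cell]
  have hle := cell_le hr hi
  have h20 := h.bound
  refine wp_seq ⟨_, _, .add s _ _ _ (by omega), _, _, .load _ d 14 ?_, ?_⟩
  · simpa [State.setReg, hc, arr, hr, hi] using hB
  · refine hQ _ ((h.setReg (by omega) _).setReg (by omega) _) rfl ?_ ?_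
    · simp [State.setReg, hc, arr, hr, hi]
    · intro a h1 h2
      simp [State.setReg, h1, h2]

theorem wp_wr (h : Ctx B l s) {r i b : ℕ} (hr : r < 9) (hb14 : b ≠ 14)
    (hi : s.reg i < width l) (hB : s.reg b ≤ B)
    (hQ : ∀ s', Ctx B l s' → arr l s' = upd (arr l s) r (s.reg i) (s.reg b) →
      (∀ a, a ≠ 14 → s'.reg a = s.reg a) → Q 2 s') :
    WP B (wr r i b) s Q := by
  have hb := h.base r hr
  have hc : s.reg (5 + r) + s.reg i = cell l r (s.reg i) := by
    rw [hb]
    simp [cell]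
  have hle := cell_le hr hi
  have h20 := h.bound
  have hs : ((s.setReg 14 (s.reg (5 + r) + s.reg i)).setMem
      ((s.setReg 14 (s.reg (5 + r) + s.reg i)).reg 14)
      ((s.setReg 14 (s.reg (5 + r) + s.reg i)).reg b)) =
      (s.setReg 14 (cell l r (s.reg i))).setMem (cell l r (s.reg i)) (s.reg b) := by
    simp [State.setReg, hc, hb14]
  refine wp_seq ⟨_, _, .add s _ _ _ (by omega), _, _, .store _ 14 b ?_, ?_⟩
  · simpa [State.setReg, hb14] using hB
  · rw [hs]
    refine hQ _ ((h.setReg le_rfl _).setMem _ _ _) ?_ ?_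
    · rw [arr_setMem hr hi, arr_setReg]
    · intro a h1
      simp [State.setReg, State.setMem, h1]

/-- Load the first endpoint of the edge number `R 16`, counted from `1`. -/
def rdFst (d : ℕ) : Prog := .seq (.add 14 16 16) (.load d 14)

/-- Load the second endpoint of the edge number `R 16`, counted from `1`. -/
def rdSnd (d : ℕ) : Prog := .seq (.add 14 16 16) (.seq (.add 14 14 1) (.load d 14))

theorem wp_rdFst (h : Ctx B l s) {d : ℕ} (hd : 15 ≤ d) {i : Fin l.length}
    (hi : s.reg 16 = i + 1)
    (hQ : ∀ s', Ctx B l s' → arr l s' = arr l s → s'.reg d = (l.get i).1 →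
      (∀ a, a ≠ 14 → a ≠ d → s'.reg a = s.reg a) → Q 2 s') :
    WP B (rdFst d) s Q := by
  have h20 := h.bound
  have hw := width_eq (l := l)
  have hi' := i.2
  have hv := (l.get i).1.2
  -- Counting edges from 1 makes the doubled number skip the two header cells.
  have hc : s.reg 16 + s.reg 16 = 2 * i + 2 := by omega
  refine wp_seq ⟨_, _, .add s _ _ _ (by omega), _, _, .load _ d 14 ?_, ?_⟩
  · have := h.fst i
    simp only [State.setReg, hc, Function.update_self]
    omega
  · refine hQ _ ((h.setReg (by omega) _).setReg (by omega) _) rfl ?_ ?_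
    · simpa [State.setReg, hc] using h.fst i
    · intro a h1 h2
      simp [State.setReg, h1, h2]

theorem wp_rdSnd (h : Ctx B l s) {d : ℕ} (hd : 15 ≤ d) {i : Fin l.length}
    (hi : s.reg 16 = i + 1)
    (hQ : ∀ s', Ctx B l s' → arr l s' = arr l s → s'.reg d = (l.get i).2 →
      (∀ a, a ≠ 14 → a ≠ d → s'.reg a = s.reg a) → Q 3 s') :
    WP B (rdSnd d) s Q := by
  have h20 := h.bound
  have hw := width_eq (l := l)
  have hi' := i.2
  have hv := (l.get i).2.2
  have hc : s.reg 16 + s.reg 16 = 2 * i + 2 := by omega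
  have h1 := h.one
  refine wp_seq ⟨_, _, .add s _ _ _ (by omega), wp_seq ⟨_, _, .add _ _ _ _ ?_, _, _,
    .load _ d 14 ?_, ?_⟩⟩
  · simp [State.setReg, hc, h1]
    omega
  · have hm : s.mem (2 * i + 2 + 1) ≤ B := by
      rw [h.snd i]
      omega
    simpa [State.setReg, hc, h1] using hm
  · refine hQ _ (((h.setReg (by omega) _).setReg (by omega) _).setReg (by omega) _) rfl ?_ ?_
    · simpa [State.setReg, hc, h1] using h.snd i
    · intro a h1 h2
      simp [State.setReg, h1, h2]

/-- Run `p` with `R 16 = 1, …, R b`. -/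
def forUp (b : ℕ) (p : Prog) : Prog :=
  .seq (.const 16 0) (.while 16 b (.seq (.add 16 16 1) p))

theorem wp_forUp {b N τ : ℕ} {p : Prog} {I : ℕ → (ℕ → ℕ → ℕ) → Prop}
    (hb : ∀ s, Ctx B l s → s.reg b = N) (hN : N < width l)
    (hbody : ∀ k < N, ∀ s, Ctx B l s → s.reg 16 = k + 1 → I k (arr l s) →
      WP B p s fun t s' => t ≤ τ ∧ Ctx B l s' ∧ s'.reg 16 = k + 1 ∧ I (k + 1) (arr l s'))
    (h : Ctx B l s) (h0 : I 0 (arr l s))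
    (hQ : ∀ t s', t ≤ N * (τ + 2) + 2 → Ctx B l s' → I N (arr l s') → Q t s') :
    WP B (forUp b p) s Q := by
  have h20 := h.bound
  refine wp_seq (wp_const h (by omega) (by omega) fun s₁ C₁ A₁ R₁ => ?_)
  refine wp_while (I := fun k s => Ctx B l s ∧ s.reg 16 = k ∧ I k (arr l s)) (N := N)
    (τ := fun _ => τ + 1) ?_ ?_ ⟨C₁, by simp [R₁], by rwa [A₁]⟩ ?_
  · rintro k hk s₂ ⟨C₂, hr, hI⟩
    refine ⟨by rw [hr, hb s₂ C₂]; exact hk, ?_⟩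
    have h1 := C₂.one
    refine wp_seq (wp_add C₂ (by omega) (by omega) fun s₃ C₃ A₃ R₃ => ?_)
    refine (hbody k hk s₃ C₃ (by simp [R₃, hr, h1]) (by rwa [A₃])).mono ?_
    rintro t s₄ ⟨ht, h4⟩
    exact ⟨by omega, h4⟩
  · rintro s₂ ⟨C₂, hr, -⟩
    rw [hr, hb s₂ C₂]
    exact lt_irrefl _
  · rintro t s₂ ht ⟨C₂, -, hI⟩
    refine hQ _ _ ?_ C₂ hI
    simp only [sum_const, card_range, smul_eq_mul] at ht
    linarith

end Layout

/-! ### Linked lists -/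

section Chain

variable {m : ℕ}

/-- The list that starts at `h` and continues along `next` consists of `xs`; item `i` is
represented by `i + 1`, and `0` marks the end. -/
def IsChain (next : ℕ → ℕ) : ℕ → List (Fin m) → Prop
  | h, [] => h = 0
  | h, i :: xs => h = i + 1 ∧ IsChain next (next (i + 1)) xs

theorem IsChain.congr {next next' : ℕ → ℕ} {xs : List (Fin m)} {h : ℕ}
    (hc : IsChain next h xs) (heq : ∀ i ∈ xs, next' ((i : ℕ) + 1) = next (i + 1)) :
    IsChain next' h xs := by
  induction xs generalizing h with
  | nil => exact hc
  | cons i xs ih =>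
    obtain ⟨h1, h2⟩ := hc
    refine ⟨h1, ?_⟩
    rw [heq i (by simp)]
    exact ih h2 fun j hj => heq j (by simp [hj])

theorem IsChain.le {next : ℕ → ℕ} {xs : List (Fin m)} {h : ℕ} (hc : IsChain next h xs) :
    h ≤ m := by
  cases xs with
  | nil => exact (show h = 0 from hc).le.trans (Nat.zero_le _)
  | cons i xs =>
    have := hc.1
    have := i.2
    omega

/-- Bucket `k` holds the items of `xs` with key `k`, the last one first. -/
def Buckets (key : Fin m → ℕ) (head next : ℕ → ℕ) (xs : List (Fin m)) : Prop :=
  ∀ k, IsChain next (head k) (xs.filter (key · = k)).reverse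

theorem Buckets.nil (key : Fin m → ℕ) (next : ℕ → ℕ) : Buckets key (fun _ => 0) next [] :=
  fun _ => rfl

/-- Only the link of the new item is overwritten. No old chain contains that item, so all of them
survive; this is what `hi` guarantees. -/
theorem Buckets.push {key : Fin m → ℕ} {head next : ℕ → ℕ} {xs : List (Fin m)}
    (hb : Buckets key head next xs) {i : Fin m} (hi : i ∉ xs) :
    Buckets key (Function.update head (key i) (i + 1))
      (Function.update next (i + 1) (head (key i))) (xs ++ [i]) := by
  intro k
  have hc : IsChain (Function.update next (i + 1) (head (key i))) (head k)
      (xs.filter (key · = k)).reverse := by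
    refine (hb k).congr fun j hj => Function.update_of_ne (fun hc => hi ?_) _ _
    have : j = i := Fin.ext (by omega)
    subst this
    exact (List.mem_filter.1 (List.mem_reverse.1 hj)).1
  by_cases hk : key i = k
  · subst hk
    rw [List.filter_append]
    simp only [decide_true, List.filter_cons_of_pos, List.filter_nil, List.reverse_append,
      List.reverse_cons, List.reverse_nil, List.nil_append, List.cons_append,
      Function.update_self]
    refine ⟨rfl, ?_⟩
    rwa [Function.update_self]
  · rw [Function.update_of_ne (Ne.symm hk), List.filter_append]
    simpa [hk] using hc

theorem sum_map_range (f : ℕ → ℕ) (K : ℕ) :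
    ((List.range K).map f).sum = ∑ k ∈ range K, f k := by
  induction K with
  | zero => simp
  | succ K ih => simp [List.range_succ, sum_range_succ, ih]

/-- One pass of a bucket sort, with `K` buckets. -/
def sortPass (K : ℕ) (key : Fin m → ℕ) (xs : List (Fin m)) : List (Fin m) :=
  (List.range K).flatMap fun k => (xs.filter (key · = k)).reverse

theorem sortPass_perm {K : ℕ} {key : Fin m → ℕ} (hk : ∀ i, key i < K) (xs : List (Fin m)) :
    (sortPass K key xs).Perm xs := by
  rw [List.perm_iff_count]
  intro i
  rw [sortPass, List.count_flatMap]
  have : ∀ k ∈ List.range K,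
      (List.count i ∘ fun k => (xs.filter (key · = k)).reverse) k =
        if k = key i then xs.count i else 0 := by
    intro k _
    simp only [Function.comp, List.count_reverse]
    split_ifs with h
    · rw [List.count_filter]
      simp [h]
    · rw [List.count_eq_zero]
      intro hc
      have := (List.mem_filter.1 hc).2
      simp at this
      exact h this.symm
  rw [List.map_congr_left this, sum_map_range]
  simp [hk i]

/-- Pushing to the front reverses each bucket, so a pass is anti-stable: ties appear in the opposite
of the previous order. -/
theorem pairwise_sortPass {K : ℕ} {key : Fin m → ℕ} {xs : List (Fin m)}
    {R : Fin m → Fin m → Prop} (hR : xs.Pairwise R) :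
    (sortPass K key xs).Pairwise fun i j => key i < key j ∨ (key i = key j ∧ R j i) := by
  rw [sortPass, List.pairwise_flatMap]
  constructor
  · intro k _
    rw [List.pairwise_reverse]
    refine (hR.filter _).imp_of_mem ?_
    intro i j hi hj h
    simp only [List.mem_filter, decide_eq_true_eq] at hi hj
    exact Or.inr ⟨hj.2.trans hi.2.symm, h⟩
  · refine List.pairwise_lt_range.imp ?_
    intro k k' hkk i hi j hj
    simp only [List.mem_reverse, List.mem_filter, decide_eq_true_eq] at hi hj
    left
    omega

end Chain

/-! ### Filling and traversing buckets on the machine. -/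

section Traverse

variable {n : ℕ} {l : List (Fin n × Fin n)} {B : ℕ} {s : State} {Q : ℕ → State → Prop}

/-- Append the item `R 16` to the front of the bucket `R 18`. -/
def push (h nx : ℕ) : Prog := .seq (rd h 19 18) (.seq (wr nx 16 19) (wr h 18 16))

theorem wp_push {h nx : ℕ} (hh : h < 9) (hnx : nx < 9) (hne : h ≠ nx) (hC : Ctx B l s)
    {key : Fin l.length → ℕ} {xs : List (Fin l.length)}
    (hb : Buckets key (arr l s h) (arr l s nx) xs) {i : Fin l.length} (hi : i ∉ xs)
    (h16 : s.reg 16 = i + 1) (h18 : s.reg 18 = key i) (hk : key i < width l)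
    (hQ : ∀ s', Ctx B l s' → Buckets key (arr l s' h) (arr l s' nx) (xs ++ [i]) →
      (∀ r, r ≠ h → r ≠ nx → arr l s' r = arr l s r) →
      (∀ a, a ≠ 14 → a ≠ 19 → s'.reg a = s.reg a) → Q 6 s') :
    WP B (push h nx) s Q := by
  have h20 := hC.bound
  have hw := width_eq (l := l)
  have hi' := i.2
  have hle := (hb (key i)).le
  refine wp_seq (wp_rd hC hh (by omega) (by omega) (by rw [h18]; omega) fun s₁ C₁ A₁ V₁ R₁ => ?_)
  have h16' := R₁ 16 (by omega) (by omega)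
  have h18' := R₁ 18 (by omega) (by omega)
  refine wp_seq (wp_wr C₁ hnx (by omega) (by omega) (by rw [V₁, h18]; omega)
    fun s₂ C₂ A₂ R₂ => ?_)
  have h16'' := R₂ 16 (by omega)
  have h18'' := R₂ 18 (by omega)
  refine wp_wr C₂ hh (by omega) (by omega) (by omega) fun s₃ C₃ A₃ R₃ => hQ s₃ C₃ ?_ ?_ ?_
  · have e1 : arr l s₃ h = Function.update (arr l s h) (key i) (i + 1) := by
      rw [A₃, upd_self, A₂, upd_of_ne _ _ _ hne, A₁, h18'', h18', h18, h16'', h16', h16]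
    have e2 : arr l s₃ nx = Function.update (arr l s nx) (i + 1) (arr l s h (key i)) := by
      rw [A₃, upd_of_ne _ _ _ hne.symm, A₂, upd_self, A₁, h16', h16, V₁, h18]
    rw [e1, e2]
    exact hb.push hi
  · intro r h1 h2
    rw [A₃, upd_of_ne _ _ _ h1, A₂, upd_of_ne _ _ _ h2, A₁]
  · intro a h1 h2
    rw [R₃ a h1, R₂ a h1, R₁ a h1 h2]

/-- Run `p` on the items of all buckets; the current item is in `R 16`. -/
def traverse (h nx : ℕ) (p : Prog) : Prog :=
  .seq (.const 15 0) (.while 15 4 (.seq (rd h 16 15)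
    (.seq (.while 0 16 (.seq p (rd nx 16 16))) (.add 15 15 1))))

/-- The decomposition of the sorted list in `hbody` tells the loop body which items are done; with
distinct items it shows that the current one is new. The body must leave the traversed lists alone.
-/
theorem wp_traverse {h nx τ : ℕ} (hh : h < 9) (hnx : nx < 9) {p : Prog}
    {key : Fin l.length → ℕ} {xs : List (Fin l.length)}
    {I : List (Fin l.length) → (ℕ → ℕ → ℕ) → Prop}
    (hbody : ∀ (done : List (Fin l.length)) (i : Fin l.length) (rest : List (Fin l.length)),
      sortPass (width l) key xs = done ++ i :: rest →
      ∀ s, Ctx B l s → s.reg 16 = i + 1 → I done (arr l s) →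
      WP B p s fun t s' => t ≤ τ ∧ Ctx B l s' ∧ s'.reg 15 = s.reg 15 ∧ s'.reg 16 = s.reg 16 ∧
        arr l s' h = arr l s h ∧ arr l s' nx = arr l s nx ∧ I (done ++ [i]) (arr l s'))
    (hC : Ctx B l s) (hb : Buckets key (arr l s h) (arr l s nx) xs) (h0 : I [] (arr l s))
    (hQ : ∀ t s', t ≤ (sortPass (width l) key xs).length * (τ + 3) + width l * 5 + 2 →
      Ctx B l s' → I (sortPass (width l) key xs) (arr l s') → Q t s') :
    WP B (traverse h nx p) s Q := by
  have h20 := hC.bound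
  have hw := width_eq (l := l)
  let L : ℕ → List (Fin l.length) := fun k => (xs.filter (key · = k)).reverse
  let total := sortPass (width l) key xs
  let pre : ℕ → List (Fin l.length) := fun k => (List.range k).flatMap L
  have hpre : ∀ k, pre (k + 1) = pre k ++ L k := by
    intro k
    simp [pre, List.range_succ]
  have htot : ∀ k < width l, ∃ rest, total = pre k ++ (L k ++ rest) := by
    intro k hk
    obtain ⟨j, hj⟩ := Nat.exists_eq_add_of_lt hk
    refine ⟨(List.range' (k + 1) j).flatMap L, ?_⟩
    have : List.range (width l) = List.range k ++ (k :: List.range' (k + 1) j) := by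
      rw [hj, ← List.range'_succ, List.range_eq_range', List.range_eq_range', add_assoc]
      simpa using (List.range'_append_1 (s := 0) (m := k) (n := j + 1)).symm
    simp only [total, sortPass, this, pre, List.flatMap_append, List.flatMap_cons]
    rfl
  refine wp_seq (wp_const hC (by omega) (by omega) fun s₁ C₁ A₁ R₁ => ?_)
  -- The cost of a round depends on the length of its bucket; the lengths add up to that of the
  -- whole list, so the total is linear although the loops are nested.
  refine wp_while (N := width l) (τ := fun k => (L k).length * (τ + 3) + 4)
    (I := fun k s' => Ctx B l s' ∧ s'.reg 15 = k ∧ arr l s' h = arr l s h ∧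
      arr l s' nx = arr l s nx ∧ I (pre k) (arr l s'))
    ?_ ?_ ⟨C₁, by simp [R₁], by rw [A₁], by rw [A₁], by rw [A₁]; exact h0⟩ ?_
  · rintro k hk s₂ ⟨C₂, h15, hAh, hAn, hI⟩
    refine ⟨by rw [h15, C₂.width]; exact hk, ?_⟩
    obtain ⟨rest, hrest⟩ := htot k hk
    have hle := (hb k).le
    refine wp_seq (wp_rd C₂ hh (by omega) (by omega) (by rw [hAh, h15]; omega)
      fun s₃ C₃ A₃ V₃ R₃ => ?_)
    rw [hAh, h15] at V₃
    have h15' := R₃ 15 (by omega) (by omega)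
    refine wp_seq (wp_while (N := (L k).length) (τ := fun _ => τ + 2)
      (I := fun j s' => Ctx B l s' ∧ s'.reg 15 = k ∧ arr l s' h = arr l s h ∧
        arr l s' nx = arr l s nx ∧ I (pre k ++ (L k).take j) (arr l s') ∧
        IsChain (arr l s nx) (s'.reg 16) ((L k).drop j)) ?_ ?_ ?_ ?_)
    · rintro j hj s₄ ⟨C₄, h15, hAh, hAn, hI, hch⟩
      rw [List.drop_eq_getElem_cons hj] at hch
      obtain ⟨h16, hch⟩ := hch
      refine ⟨by rw [C₄.zero, h16]; omega, ?_⟩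
      refine wp_seq ((hbody (pre k ++ (L k).take j) (L k)[j] ((L k).drop (j + 1) ++ rest) ?_
        s₄ C₄ h16 hI).mono ?_)
      · change total = _
        rw [hrest]
        have e := List.take_append_drop j (L k)
        rw [List.drop_eq_getElem_cons hj] at e
        conv_lhs => rw [← e]
        simp only [List.append_assoc, List.cons_append]
      · rintro t s₅ ⟨ht, C₅, h15', h16', hAh', hAn', hI'⟩
        have hi' := (L k)[j].2
        have hle := hch.le
        refine wp_rd C₅ hnx (by omega) (by omega) (by rw [hAn', hAn, h16', h16]; omega)
          fun s₆ C₆ A₆ V₆ R₆ => ?_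
        refine ⟨by omega, C₆, ?_, ?_, ?_, ?_, ?_⟩
        · rw [R₆ 15 (by omega) (by omega), h15', h15]
        · rw [A₆, hAh', hAh]
        · rw [A₆, hAn', hAn]
        · rw [A₆, List.take_succ_eq_append_getElem hj, ← List.append_assoc]
          exact hI'
        · rw [V₆, hAn', hAn, h16', h16]
          exact hch
    · rintro s₄ ⟨C₄, -, -, -, -, hch⟩
      rw [List.drop_length] at hch
      have hz : s₄.reg 16 = 0 := hch
      rw [hz]
      omega
    · refine ⟨C₃, by rw [h15', h15], by rw [A₃, hAh], by rw [A₃, hAn], ?_, ?_⟩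
      · rw [A₃, List.take_zero, List.append_nil]
        exact hI
      · rw [V₃, List.drop_zero]
        exact hb k
    · rintro t s₄ ht ⟨C₄, h15, hAh, hAn, hI, -⟩
      have h1 := C₄.one
      refine wp_add C₄ (by omega) (by omega) fun s₅ C₅ A₅ R₅ => ⟨?_, C₅, ?_, ?_, ?_, ?_⟩
      · simp only [sum_const, card_range, smul_eq_mul] at ht
        have e : (L k).length * (τ + 2 + 1) = (L k).length * (τ + 3) := rfl
        omega
      · simp [R₅, h15, h1]
      · rw [A₅, hAh]
      · rw [A₅, hAn]
      · rw [A₅, hpre]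
        rwa [List.take_length] at hI
  · rintro s₂ ⟨C₂, h15, -⟩
    rw [h15, C₂.width]
    exact lt_irrefl _
  · rintro t s₂ ht ⟨C₂, -, -, -, hI⟩
    refine hQ _ _ ?_ C₂ hI
    have hlen : (sortPass (width l) key xs).length = ∑ k ∈ range (width l), (L k).length := by
      rw [sortPass, List.length_flatMap]
      exact sum_map_range _ _
    rw [hlen, sum_mul]
    simp only [sum_add_distrib, sum_const, card_range, smul_eq_mul] at ht
    linarith

end Traverse

/-! ### Initialization of constants and base addresses. -/

section Setup

variable {n : ℕ} {l : List (Fin n × Fin n)} {B : ℕ} {s : State} {Q : ℕ → State → Prop}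

/-- This rule and the next two do not presuppose `Ctx`, which the set-up code has yet to establish.
-/
theorem wp_const' {d k : ℕ} (hk : k ≤ B) (hQ : Q 1 (s.setReg d k)) : WP B (.const d k) s Q :=
  ⟨_, _, .const s d k hk, hQ⟩

theorem wp_add' {d a b : ℕ} (x : ℕ) (hx : s.reg a + s.reg b = x) (hB : x ≤ B)
    (hQ : Q 1 (s.setReg d x)) : WP B (.add d a b) s Q := by
  subst hx
  exact ⟨_, _, .add s d a b hB, hQ⟩

theorem wp_load' {d a : ℕ} (x : ℕ) (hx : s.mem (s.reg a) = x) (hB : x ≤ B)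
    (hQ : Q 1 (s.setReg d x)) : WP B (.load d a) s Q := by
  subst hx
  exact ⟨_, _, .load s d a hB, hQ⟩

theorem getD_flatMap_pair {β : Type*} (f g : β → ℕ) (l : List β) (i : Fin l.length) :
    (l.flatMap fun e => [f e, g e]).getD (2 * i) 0 = f (l.get i) ∧
      (l.flatMap fun e => [f e, g e]).getD (2 * i + 1) 0 = g (l.get i) := by
  induction l with
  | nil => exact i.elim0
  | cons e l ih =>
    refine Fin.cases ?_ (fun i => ?_) i
    · simp
    · have := ih i
      simpa [Nat.mul_add] using this

theorem length_flatMap_pair {β : Type*} (f g : β → ℕ) (l : List β) :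
    (l.flatMap fun e => [f e, g e]).length = 2 * l.length := by
  induction l with
  | nil => rfl
  | cons e l ih =>
    simp only [List.flatMap_cons, List.length_append, ih, List.length_cons, List.length_nil]
    omega

theorem inputState_mem_fst (i : Fin l.length) :
    (inputState l).mem (2 * i + 2) = (l.get i).1 :=
  (getD_flatMap_pair (fun e : Fin n × Fin n => (e.1 : ℕ)) (fun e => (e.2 : ℕ)) l i).1

theorem inputState_mem_snd (i : Fin l.length) :
    (inputState l).mem (2 * i + 3) = (l.get i).2 :=
  (getD_flatMap_pair (fun e : Fin n × Fin n => (e.1 : ℕ)) (fun e => (e.2 : ℕ)) l i).2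

theorem inputState_mem_eq_zero {a : ℕ} (ha : 2 + 2 * l.length ≤ a) :
    (inputState l).mem a = 0 := by
  refine List.getD_eq_default _ _ ?_
  simp only [List.length_cons, length_flatMap_pair]
  omega

/-- Load the constants and compute the base addresses. -/
def setup : Prog :=
  .seq (.const 1 1) (.seq (.load 2 0) (.seq (.load 3 1) (.seq (.add 4 2 3) (.seq (.add 4 4 1)
  (.seq (.const 5 2) (.seq (.add 5 5 3) (.seq (.add 5 5 3) (.seq (.add 6 5 4)
  (.seq (.add 7 6 4) (.seq (.add 8 7 4) (.seq (.add 9 8 4) (.seq (.add 10 9 4)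
  (.seq (.add 11 10 4) (.seq (.add 12 11 4) (.add 13 12 4)))))))))))))))

theorem wp_setup (hB : 20 * width l ≤ B)
    (hQ : ∀ s', Ctx B l s' → (∀ r, arr l s' r = 0) → Q 16 s') :
    WP B setup (inputState l) Q := by
  have hw := width_eq (l := l)
  have m0 : (inputState l).mem 0 = n := rfl
  have m1 : (inputState l).mem 1 = l.length := rfl
  have r0 : ∀ r, (inputState l).reg r = 0 := fun _ => rfl
  refine wp_seq (wp_const' (by omega) ?_)
  refine wp_seq (wp_load' n (by simp [State.setReg, r0, m0]) (by omega) ?_)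
  refine wp_seq (wp_load' l.length (by simp [State.setReg, m1]) (by omega) ?_)
  refine wp_seq (wp_add' (n + l.length) (by simp [State.setReg]) (by omega) ?_)
  refine wp_seq (wp_add' (width l) (by simp [State.setReg, hw]) (by omega) ?_)
  refine wp_seq (wp_const' (by omega) ?_)
  refine wp_seq (wp_add' (2 + l.length) (by simp [State.setReg]) (by omega) ?_)
  refine wp_seq (wp_add' (2 + 2 * l.length) (by simp [State.setReg]; omega) (by omega) ?_)
  refine wp_seq (wp_add' (2 + 2 * l.length + width l) (by simp [State.setReg]) (by omega) ?_)
  refine wp_seq (wp_add' (2 + 2 * l.length + 2 * width l) (by simp [State.setReg]; omega)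
    (by omega) ?_)
  refine wp_seq (wp_add' (2 + 2 * l.length + 3 * width l) (by simp [State.setReg]; omega)
    (by omega) ?_)
  refine wp_seq (wp_add' (2 + 2 * l.length + 4 * width l) (by simp [State.setReg]; omega)
    (by omega) ?_)
  refine wp_seq (wp_add' (2 + 2 * l.length + 5 * width l) (by simp [State.setReg]; omega)
    (by omega) ?_)
  refine wp_seq (wp_add' (2 + 2 * l.length + 6 * width l) (by simp [State.setReg]; omega)
    (by omega) ?_)
  refine wp_seq (wp_add' (2 + 2 * l.length + 7 * width l) (by simp [State.setReg]; omega)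
    (by omega) ?_)
  refine wp_add' (2 + 2 * l.length + 8 * width l) (by simp [State.setReg]; omega) (by omega)
    (hQ _ ⟨hB, ?_, ?_, ?_, ?_, ?_, ?_, inputState_mem_fst, inputState_mem_snd⟩ ?_)
  · simp [State.setReg, r0]
  · simp [State.setReg]
  · simp [State.setReg]
  · simp [State.setReg]
  · simp [State.setReg]
  · intro r hr
    interval_cases r <;> simp [State.setReg, cell]
  · intro r
    funext i
    have : arr l (inputState l) r i = 0 := by
      unfold arr
      split_ifs with h
      · refine inputState_mem_eq_zero ?_
        unfold cell
        omega
      · rfl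
    exact this

end Setup

/-! ### Labels, degrees and directed edges. -/

section Phases

variable {n : ℕ} {l : List (Fin n × Fin n)} {B : ℕ} {s : State} {Q : ℕ → State → Prop}

/-- Every vertex is its own label. -/
def initLabels : Prog := forUp 2 (.seq (.sub 17 16 1) (wr 0 17 17))

theorem wp_initLabels (h : Ctx B l s) (h0 : ∀ r, arr l s r = 0)
    (hQ : ∀ t s', t ≤ n * 5 + 2 → Ctx B l s' → (∀ v < n, arr l s' 0 v = v) →
      (∀ r, 1 ≤ r → arr l s' r = 0) → Q t s') :
    WP B initLabels s Q := by
  have h20 := h.bound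
  have hw := width_eq (l := l)
  refine wp_forUp (N := n) (τ := 3)
    (I := fun k A => (∀ v < k, A 0 v = v) ∧ ∀ r, 1 ≤ r → A r = 0)
    (fun s C => C.size) (by omega) ?_ h ⟨by simp, fun r _ => h0 r⟩
    (fun t s' ht hC hI => hQ t s' ht hC hI.1 hI.2)
  rintro k hk s C h16 ⟨hI, hI'⟩
  have h1 := C.one
  refine wp_seq (wp_sub C (by omega) (by omega) fun s₁ C₁ A₁ R₁ => ?_)
  have h17 : s₁.reg 17 = k := by simp [R₁, h16, h1]
  refine wp_wr C₁ (by omega) (by omega) (by omega) (by omega) fun s₂ C₂ A₂ R₂ =>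
    ⟨by omega, C₂, ?_, ?_, ?_⟩
  · rw [R₂ 16 (by omega)]
    simp [R₁, h16]
  · intro v hv
    rw [A₂, A₁, upd_self, h17]
    by_cases hvk : v = k
    · simp [hvk]
    · rw [Function.update_of_ne hvk]
      exact hI v (by omega)
  · intro r hr
    rw [A₂, A₁, upd_of_ne _ _ _ (by omega)]
    exact hI' r hr

/-- Increment the degree of the vertex `R i`. -/
def inc (i : ℕ) : Prog := .seq (rd 1 19 i) (.seq (.add 19 19 1) (wr 1 i 19))

theorem wp_inc (h : Ctx B l s) {i : ℕ} (hi14 : i ≠ 14) (hi19 : i ≠ 19) (hi : s.reg i < width l)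
    (hB : arr l s 1 (s.reg i) + 1 ≤ B)
    (hQ : ∀ s', Ctx B l s' →
      arr l s' = upd (arr l s) 1 (s.reg i) (arr l s 1 (s.reg i) + 1) →
      (∀ a, a ≠ 14 → a ≠ 19 → s'.reg a = s.reg a) → Q 5 s') :
    WP B (inc i) s Q := by
  refine wp_seq (wp_rd h (by omega) (by omega) hi (by omega) fun s₁ C₁ A₁ V₁ R₁ => ?_)
  have h1 := C₁.one
  refine wp_seq (wp_add C₁ (by omega) (by omega) fun s₂ C₂ A₂ R₂ => ?_)
  have e2 : s₂.reg i = s.reg i := by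
    rw [R₂, Function.update_of_ne hi19, R₁ i hi14 hi19]
  have v2 : s₂.reg 19 = arr l s 1 (s.reg i) + 1 := by simp [R₂, V₁, h1]
  refine wp_wr C₂ (by omega) (by omega) (by omega) (by omega) fun s₃ C₃ A₃ R₃ => hQ s₃ C₃ ?_ ?_
  · rw [A₃, A₂, A₁, e2, v2]
  · intro a h1 h2
    rw [R₃ a h1, R₂, Function.update_of_ne h2, R₁ a h1 h2]

/-- How often `v` occurs as an endpoint in `l`. -/
def endpointCount (l : List (Fin n × Fin n)) (v : Fin n) : ℕ :=
  (l.map Prod.fst).count v + (l.map Prod.snd).count v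

theorem endpointCount_le (l : List (Fin n × Fin n)) (v : Fin n) :
    endpointCount l v ≤ 2 * l.length := by
  have h1 := List.count_le_length (a := v) (l := l.map Prod.fst)
  have h2 := List.count_le_length (a := v) (l := l.map Prod.snd)
  simp only [List.length_map] at h1 h2
  unfold endpointCount
  omega

theorem endpointCount_take_succ (l : List (Fin n × Fin n)) (i : Fin l.length) (v : Fin n) :
    endpointCount (l.take (i + 1)) v = endpointCount (l.take i) v +
      (if v = (l.get i).1 then 1 else 0) + (if v = (l.get i).2 then 1 else 0) := by
  rw [List.take_succ_eq_append_getElem i.2]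
  simp only [endpointCount, List.map_append, List.count_append, List.map_cons, List.map_nil,
    List.count_singleton, List.get_eq_getElem, beq_iff_eq, eq_comm (a := v)]
  omega

/-- Compute the degrees. -/
def countDegrees : Prog :=
  forUp 3 (.seq (rdFst 17) (.seq (rdSnd 18) (.seq (inc 17) (inc 18))))

theorem wp_countDegrees (h : Ctx B l s) (h0 : ∀ v < n, arr l s 0 v = v)
    (hz : ∀ r, 1 ≤ r → arr l s r = 0)
    (hQ : ∀ t s', t ≤ l.length * 17 + 2 → Ctx B l s' → (∀ v < n, arr l s' 0 v = v) →
      (∀ v : Fin n, arr l s' 1 v = endpointCount l v) →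
      (∀ r, 2 ≤ r → arr l s' r = 0) → Q t s') :
    WP B countDegrees s Q := by
  have h20 := h.bound
  have hw := width_eq (l := l)
  refine wp_forUp (N := l.length) (τ := 15)
    (I := fun k A => (∀ v < n, A 0 v = v) ∧
      (∀ v : Fin n, A 1 v = endpointCount (l.take k) v) ∧ ∀ r, 2 ≤ r → A r = 0)
    (fun s C => C.length) (by omega) ?_ h ⟨h0, ?_, fun r hr => hz r (by omega)⟩
    (fun t s' ht hC hI => hQ t s' ht hC hI.1 (by simpa using hI.2.1) hI.2.2)
  swap
  · intro v
    rw [hz 1 le_rfl]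
    simp [endpointCount]
  rintro k hk s C h16 ⟨hI, hI1, hI2⟩
  let i : Fin l.length := ⟨k, hk⟩
  have hu := (l.get i).1.2
  have hv := (l.get i).2.2
  have hstep := endpointCount_take_succ l i
  have hle : ∀ j v, endpointCount (l.take j) v ≤ 2 * l.length := fun j v =>
    (endpointCount_le _ v).trans (Nat.mul_le_mul_left _ (List.length_take_le' _ _))
  refine wp_seq (wp_rdFst C (by omega) (i := i) h16 fun s₁ C₁ A₁ V₁ R₁ => ?_)
  have h16₁ := R₁ 16 (by omega) (by omega)
  refine wp_seq (wp_rdSnd C₁ (by omega) (i := i) (h16₁.trans h16) fun s₂ C₂ A₂ V₂ R₂ => ?_)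
  have h17₂ := R₂ 17 (by omega) (by omega)
  rw [V₁] at h17₂
  have h16₂ := R₂ 16 (by omega) (by omega)
  have hB₂ : arr l s₂ 1 (s₂.reg 17) ≤ 2 * l.length := by
    rw [h17₂, A₂, A₁, hI1]
    exact hle _ _
  refine wp_seq (wp_inc C₂ (by omega) (by omega) (by omega) (by omega) fun s₃ C₃ A₃ R₃ => ?_)
  have h18₃ := R₃ 18 (by omega) (by omega)
  rw [V₂] at h18₃
  have h16₃ := R₃ 16 (by omega) (by omega)
  have hA₃ : ∀ v : Fin n, arr l s₃ 1 v = endpointCount (l.take k) v +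
      if v = (l.get i).1 then 1 else 0 := by
    intro v
    rw [A₃, A₂, A₁, upd_self, h17₂]
    by_cases hv : v = (l.get i).1
    · rw [if_pos hv, hv, Function.update_self, hI1]
    · rw [if_neg hv, Function.update_of_ne (fun hc => hv (Fin.ext hc)), hI1, add_zero]
  have hB₃ : arr l s₃ 1 (s₃.reg 18) ≤ 2 * l.length + 1 := by
    rw [h18₃, hA₃]
    have := hle k (l.get i).2
    split_ifs <;> omega
  refine wp_inc C₃ (by omega) (by omega) (by omega) (by omega) fun s₄ C₄ A₄ R₄ =>
    ⟨by omega, C₄, ?_, ?_, ?_, ?_⟩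
  · rw [R₄ 16 (by omega) (by omega)]
    omega
  · intro v hv
    rw [A₄, upd_of_ne _ _ _ (by omega), A₃, upd_of_ne _ _ _ (by omega), A₂, A₁]
    exact hI v hv
  · intro v
    have hs : endpointCount (l.take (k + 1)) v = _ := hstep v
    rw [hs, A₄, upd_self, h18₃]
    by_cases hv : v = (l.get i).2
    · rw [if_pos hv, ← hv, Function.update_self, hA₃]
    · rw [if_neg hv, Function.update_of_ne (fun hc => hv (Fin.ext hc)), hA₃, add_zero]
  · intro r hr
    rw [A₄, upd_of_ne _ _ _ (by omega), A₃, upd_of_ne _ _ _ (by omega), A₂, A₁]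
    exact hI2 r hr

/-- The edge `e`, directed towards the endpoint of larger degree. -/
def orient (d : Fin n → ℕ) (e : Fin n × Fin n) : Fin n × Fin n :=
  if d e.2 < d e.1 then e.swap else e

/-- The degrees and the directed edges have been computed. -/
structure Prepared (l : List (Fin n × Fin n)) (d : Fin n → ℕ) (A : ℕ → ℕ → ℕ) : Prop where
  deg : ∀ v : Fin n, A 1 v = d v
  fst : ∀ i : Fin l.length, A 7 (i + 1) = (orient d (l.get i)).1
  snd : ∀ i : Fin l.length, A 8 (i + 1) = (orient d (l.get i)).2

theorem Prepared.congr {d : Fin n → ℕ} {A A' : ℕ → ℕ → ℕ} (h : Prepared l d A)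
    (h1 : A' 1 = A 1) (h7 : A' 7 = A 7) (h8 : A' 8 = A 8) : Prepared l d A' :=
  ⟨fun v => by rw [h1, h.deg], fun i => by rw [h7, h.fst], fun i => by rw [h8, h.snd]⟩

/-- Direct the edges. -/
def orientEdges : Prog :=
  forUp 3 (.seq (rdFst 17) (.seq (rdSnd 18) (.seq (rd 1 19 17) (.seq (rd 1 20 18)
    (.ite 20 19 (.seq (wr 7 16 18) (wr 8 16 17)) (.seq (wr 7 16 17) (wr 8 16 18)))))))

theorem wp_orientEdges {d : Fin n → ℕ} (hd : ∀ v, d v ≤ n) (h : Ctx B l s)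
    (h0 : ∀ v < n, arr l s 0 v = v) (h1 : ∀ v : Fin n, arr l s 1 v = d v)
    (hz : ∀ r, 2 ≤ r → arr l s r = 0)
    (hQ : ∀ t s', t ≤ l.length * 16 + 2 → Ctx B l s' → (∀ v < n, arr l s' 0 v = v) →
      Prepared l d (arr l s') → (∀ r, 2 ≤ r → r ≤ 6 → arr l s' r = 0) → Q t s') :
    WP B orientEdges s Q := by
  have h20 := h.bound
  have hw := width_eq (l := l)
  refine wp_forUp (N := l.length) (τ := 14)
    (I := fun k A => (∀ v < n, A 0 v = v) ∧ (∀ v : Fin n, A 1 v = d v) ∧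
      (∀ r, 2 ≤ r → r ≤ 6 → A r = 0) ∧ ∀ i : Fin l.length, (i : ℕ) < k →
        A 7 (i + 1) = (orient d (l.get i)).1 ∧ A 8 (i + 1) = (orient d (l.get i)).2)
    (fun s C => C.length) (by omega) ?_ h ⟨h0, h1, fun r hr _ => hz r hr, by simp⟩
    (fun t s' ht hC ⟨i1, i2, i3, i4⟩ => hQ t s' ht hC i1
      ⟨i2, fun i => (i4 i i.2).1, fun i => (i4 i i.2).2⟩ i3)
  rintro k hk s C h16 ⟨hI0, hI1, hI2, hI3⟩
  obtain ⟨i, hik⟩ : ∃ i : Fin l.length, (i : ℕ) = k := ⟨⟨k, hk⟩, rfl⟩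
  rw [← hik] at h16
  have hu := (l.get i).1.2
  have hv := (l.get i).2.2
  have hdu := hd (l.get i).1
  have hdv := hd (l.get i).2
  refine wp_seq (wp_rdFst C (by omega) h16 fun s₁ C₁ A₁ V₁ R₁ => ?_)
  have h16₁ := R₁ 16 (by omega) (by omega)
  refine wp_seq (wp_rdSnd C₁ (by omega) (h16₁.trans h16) fun s₂ C₂ A₂ V₂ R₂ => ?_)
  have h17₂ := R₂ 17 (by omega) (by omega)
  rw [V₁] at h17₂
  have h16₂ := R₂ 16 (by omega) (by omega)
  have hD₂ : ∀ v : Fin n, arr l s₂ 1 v = d v := by rwa [A₂, A₁]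
  refine wp_seq (wp_rd C₂ (by omega) (by omega) (by omega) (by rw [h17₂, hD₂]; omega)
    fun s₃ C₃ A₃ V₃ R₃ => ?_)
  rw [h17₂, hD₂] at V₃
  have h18₃ := R₃ 18 (by omega) (by omega)
  rw [V₂] at h18₃
  refine wp_seq (wp_rd C₃ (by omega) (by omega) (by omega) (by rw [h18₃, A₃, hD₂]; omega)
    fun s₄ C₄ A₄ V₄ R₄ => ?_)
  rw [h18₃, A₃, hD₂] at V₄
  have h19₄ : s₄.reg 19 = d (l.get i).1 := by rw [R₄ 19 (by omega) (by omega), V₃]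
  have h18₄ : s₄.reg 18 = (l.get i).2 := by rw [R₄ 18 (by omega) (by omega), h18₃]
  have h17₄ : s₄.reg 17 = (l.get i).1 := by
    rw [R₄ 17 (by omega) (by omega), R₃ 17 (by omega) (by omega), h17₂]
  have h16₄ : s₄.reg 16 = i + 1 := by
    rw [R₄ 16 (by omega) (by omega), R₃ 16 (by omega) (by omega)]
    omega
  have hA₄ : arr l s₄ = arr l s := by rw [A₄, A₃, A₂, A₁]
  -- Both branches store a directed pair in arrays 7 and 8; this restores the invariant for either.
  have key : ∀ (a b : Fin n) (s' : State),
      arr l s' = upd (upd (arr l s) 7 (i + 1) a) 8 (i + 1) b → orient d (l.get i) = (a, b) →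
      (∀ v < n, arr l s' 0 v = v) ∧ (∀ v : Fin n, arr l s' 1 v = d v) ∧
      (∀ r, 2 ≤ r → r ≤ 6 → arr l s' r = 0) ∧ ∀ i : Fin l.length, (i : ℕ) < k + 1 →
        arr l s' 7 (i + 1) = (orient d (l.get i)).1 ∧
          arr l s' 8 (i + 1) = (orient d (l.get i)).2 := by
    intro a b s' hA ho
    have hr : ∀ r, r ≤ 6 → arr l s' r = arr l s r := by
      intro r hr
      rw [hA, upd_of_ne _ _ _ (by omega), upd_of_ne _ _ _ (by omega)]
    refine ⟨?_, ?_, ?_, ?_⟩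
    · rwa [hr 0 (by omega)]
    · rwa [hr 1 (by omega)]
    · intro r h2 h6
      rw [hr r h6, hI2 r h2 h6]
    · intro j hj
      have e7 : arr l s' 7 = Function.update (arr l s 7) (i + 1) a := by
        rw [hA, upd_of_ne _ _ _ (by omega), upd_self]
      have e8 : arr l s' 8 = Function.update (arr l s 8) (i + 1) b := by
        rw [hA, upd_self, upd_of_ne _ _ _ (by omega)]
      rw [e7, e8]
      by_cases hji : j = i
      · subst hji
        rw [ho, Function.update_self, Function.update_self]
        exact ⟨rfl, rfl⟩
      · have hne : (j : ℕ) + 1 ≠ i + 1 := fun hc => hji (Fin.ext (by omega))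
        rw [Function.update_of_ne hne, Function.update_of_ne hne]
        refine hI3 j ?_
        omega
  refine wp_ite (fun hlt => ?_) (fun hlt => ?_)
  · rw [V₄, h19₄] at hlt
    refine wp_seq (wp_wr C₄ (by omega) (by omega) (by omega) (by omega) fun s₅ C₅ A₅ R₅ => ?_)
    have h16₅ := R₅ 16 (by omega)
    have h17₅ := R₅ 17 (by omega)
    refine wp_wr C₅ (by omega) (by omega) (by omega) (by omega) fun s₆ C₆ A₆ R₆ =>
      ⟨by omega, C₆, ?_, ?_⟩
    · rw [R₆ 16 (by omega)]
      omega
    · refine key (l.get i).2 (l.get i).1 s₆ ?_ ?_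
      · rw [A₆, A₅, hA₄, h16₅, h17₅, h16₄, h17₄, h18₄]
      · rw [orient, if_pos hlt]
        rfl
  · rw [V₄, h19₄] at hlt
    refine wp_seq (wp_wr C₄ (by omega) (by omega) (by omega) (by omega) fun s₅ C₅ A₅ R₅ => ?_)
    have h16₅ := R₅ 16 (by omega)
    have h18₅ := R₅ 18 (by omega)
    refine wp_wr C₅ (by omega) (by omega) (by omega) (by omega) fun s₆ C₆ A₆ R₆ =>
      ⟨by omega, C₆, ?_, ?_⟩
    · rw [R₆ 16 (by omega)]
      omega
    · refine key (l.get i).1 (l.get i).2 s₆ ?_ ?_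
      · rw [A₆, A₅, hA₄, h16₅, h18₅, h16₄, h17₄, h18₄]
      · rw [orient, if_neg hlt]

end Phases

/-! ### Sorting the edges, the greedy phase and the whole program. -/

section Sorting

variable {n : ℕ} {l : List (Fin n × Fin n)} {B : ℕ} {s : State} {Q : ℕ → State → Prop}

theorem orient_le (d : Fin n → ℕ) (e : Fin n × Fin n) : d (orient d e).1 ≤ d (orient d e).2 := by
  unfold orient
  split_ifs with h
  · exact h.le
  · exact not_lt.1 h

/-- The key of the first sorting pass: small for a tail of large degree. -/
def tailKey (l : List (Fin n × Fin n)) (d : Fin n → ℕ) (i : Fin l.length) : ℕ :=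
  n - d (orient d (l.get i)).1

/-- The key of the second sorting pass: the degree of the head. -/
def headKey (l : List (Fin n × Fin n)) (d : Fin n → ℕ) (i : Fin l.length) : ℕ :=
  d (orient d (l.get i)).2

theorem tailKey_lt (d : Fin n → ℕ) (i : Fin l.length) : tailKey l d i < width l := by
  unfold tailKey width
  omega

theorem headKey_lt {d : Fin n → ℕ} (hd : ∀ v, d v ≤ n) (i : Fin l.length) :
    headKey l d i < width l := by
  have := hd (orient d (l.get i)).2
  unfold headKey width
  omega

/-- The edges after the first sorting pass. -/
def tailSorted (l : List (Fin n × Fin n)) (d : Fin n → ℕ) : List (Fin l.length) :=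
  sortPass (width l) (tailKey l d) (List.finRange l.length)

/-- The edges after both sorting passes. -/
def edgesSorted (l : List (Fin n × Fin n)) (d : Fin n → ℕ) : List (Fin l.length) :=
  sortPass (width l) (headKey l d) (tailSorted l d)

theorem tailSorted_perm (d : Fin n → ℕ) : (tailSorted l d).Perm (List.finRange l.length) :=
  sortPass_perm (tailKey_lt d) _

theorem edgesSorted_perm {d : Fin n → ℕ} (hd : ∀ v, d v ≤ n) :
    (edgesSorted l d).Perm (List.finRange l.length) :=
  (sortPass_perm (headKey_lt hd) _).trans (tailSorted_perm d)

/-- The second pass reverses ties, which is why the first one sorts by n minus the tail degree: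
descending tail degrees become ascending within each head degree. -/
theorem pairwise_edgesSorted {d : Fin n → ℕ} (hd : ∀ v, d v ≤ n) :
    ((edgesSorted l d).map fun i => orient d (l.get i)).Pairwise (EdgeLE d) := by
  rw [List.pairwise_map]
  have h1 := pairwise_sortPass (K := width l) (key := tailKey l d)
    (R := fun _ _ => True) (xs := List.finRange l.length)
    (List.pairwise_of_forall fun _ _ => trivial)
  refine (pairwise_sortPass (key := headKey l d) h1).imp ?_
  rintro i j (h | ⟨h, h'⟩)
  · exact Or.inl h
  · refine Or.inr ⟨h, ?_⟩
    have hi := hd (orient d (l.get i)).1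
    have hj := hd (orient d (l.get j)).1
    unfold tailKey at h'
    omega

/-- The first sorting pass. -/
def bucketTails : Prog :=
  forUp 3 (.seq (rd 7 17 16) (.seq (rd 1 18 17) (.seq (.sub 18 2 18) (push 3 4))))

theorem wp_bucketTails {d : Fin n → ℕ} (hd : ∀ v, d v ≤ n) (h : Ctx B l s)
    (h0 : ∀ v < n, arr l s 0 v = v) (hp : Prepared l d (arr l s))
    (hz : ∀ r, 2 ≤ r → r ≤ 6 → arr l s r = 0)
    (hQ : ∀ t s', t ≤ l.length * 13 + 2 → Ctx B l s' → (∀ v < n, arr l s' 0 v = v) →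
      Prepared l d (arr l s') → arr l s' 2 = 0 → arr l s' 5 = 0 →
      Buckets (tailKey l d) (arr l s' 3) (arr l s' 4) (List.finRange l.length) → Q t s') :
    WP B bucketTails s Q := by
  have h20 := h.bound
  have hw := width_eq (l := l)
  refine wp_forUp (N := l.length) (τ := 11)
    (I := fun k A => (∀ v < n, A 0 v = v) ∧ Prepared l d A ∧ A 2 = 0 ∧ A 5 = 0 ∧
      Buckets (tailKey l d) (A 3) (A 4) ((List.finRange l.length).take k))
    (fun s C => C.length) (by omega) ?_ h
    ⟨h0, hp, hz 2 (by omega) (by omega), hz 5 (by omega) (by omega), ?_⟩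
    (fun t s' ht hC ⟨i1, i2, i3, i4, i5⟩ => hQ t s' ht hC i1 i2 i3 i4 ?_)
  · rintro k hk s C h16 ⟨hI, hP, hI2, hI5, hb⟩
    obtain ⟨i, hik⟩ : ∃ i : Fin l.length, (i : ℕ) = k := ⟨⟨k, hk⟩, rfl⟩
    rw [← hik] at h16
    have hu := (orient d (l.get i)).1.2
    have hdu := hd (orient d (l.get i)).1
    refine wp_seq (wp_rd C (by omega) (by omega) (by omega) (by rw [h16, hP.fst]; omega)
      fun s₁ C₁ A₁ V₁ R₁ => ?_)
    rw [h16, hP.fst] at V₁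
    have h16₁ := R₁ 16 (by omega) (by omega)
    refine wp_seq (wp_rd C₁ (by omega) (by omega) (by omega)
      (by rw [V₁, A₁, hP.deg]; omega) fun s₂ C₂ A₂ V₂ R₂ => ?_)
    rw [V₁, A₁, hP.deg] at V₂
    have h16₂ := R₂ 16 (by omega) (by omega)
    have h2 := C₂.size
    refine wp_seq (wp_sub C₂ (by omega) (by omega) fun s₃ C₃ A₃ R₃ => ?_)
    have h16₃ : s₃.reg 16 = i + 1 := by
      rw [R₃, Function.update_of_ne (by omega), h16₂, h16₁, h16]
    have h18₃ : s₃.reg 18 = tailKey l d i := by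
      rw [R₃, Function.update_self, h2, V₂]
      rfl
    have hA : arr l s₃ = arr l s := by rw [A₃, A₂, A₁]
    have htake : (List.finRange l.length).take (k + 1) =
        (List.finRange l.length).take k ++ [i] := by
      rw [List.take_succ_eq_append_getElem (by simpa using hk)]
      simp [Fin.ext_iff, hik]
    have hni : i ∉ (List.finRange l.length).take k := by
      have hnd := (List.nodup_finRange l.length).sublist (List.take_sublist (k + 1) _)
      rw [htake] at hnd
      intro hc
      exact (List.nodup_append.1 hnd).2.2 i hc i (by simp) rfl
    refine wp_push (by omega) (by omega) (by omega) C₃ (by rwa [hA]) hni h16₃ h18₃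
      (tailKey_lt d i) fun s₄ C₄ B₄ A₄ R₄ => ⟨by omega, C₄, ?_, ?_, ?_, ?_, ?_, ?_⟩
    · rw [R₄ 16 (by omega) (by omega)]
      omega
    · rwa [A₄ 0 (by omega) (by omega), hA]
    · rw [← hA] at hP
      exact hP.congr (A₄ 1 (by omega) (by omega)) (A₄ 7 (by omega) (by omega))
        (A₄ 8 (by omega) (by omega))
    · rwa [A₄ 2 (by omega) (by omega), hA]
    · rwa [A₄ 5 (by omega) (by omega), hA]
    · rwa [htake]
  · rw [hz 3 (by omega) (by omega)]
    exact Buckets.nil _ _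
  · rwa [List.take_of_length_le (by simp)] at i5

/-- The second sorting pass. -/
def bucketHeads : Prog := traverse 3 4 (.seq (rd 8 17 16) (.seq (rd 1 18 17) (push 5 6)))

theorem wp_bucketHeads {d : Fin n → ℕ} (hd : ∀ v, d v ≤ n) (h : Ctx B l s)
    (h0 : ∀ v < n, arr l s 0 v = v) (hp : Prepared l d (arr l s))
    (hz2 : arr l s 2 = 0) (hz5 : arr l s 5 = 0)
    (hb : Buckets (tailKey l d) (arr l s 3) (arr l s 4) (List.finRange l.length))
    (hQ : ∀ t s', t ≤ l.length * 13 + width l * 5 + 2 → Ctx B l s' →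
      (∀ v < n, arr l s' 0 v = v) → Prepared l d (arr l s') → arr l s' 2 = 0 →
      Buckets (headKey l d) (arr l s' 5) (arr l s' 6) (tailSorted l d) → Q t s') :
    WP B bucketHeads s Q := by
  have h20 := h.bound
  have hw := width_eq (l := l)
  refine wp_traverse (by omega) (by omega) (τ := 10)
    (I := fun done A => (∀ v < n, A 0 v = v) ∧ Prepared l d A ∧ A 2 = 0 ∧
      Buckets (headKey l d) (A 5) (A 6) done) ?_ h hb
    ⟨h0, hp, hz2, by rw [hz5]; exact Buckets.nil _ _⟩
    (fun t s' ht hC ⟨i1, i2, i3, i4⟩ => hQ t s' ?_ hC i1 i2 i3 i4)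
  · rintro done i rest htot s C h16 ⟨hI, hP, hI2, hb⟩
    have hu := (orient d (l.get i)).2.2
    have hdu := hd (orient d (l.get i)).2
    have hi := i.2
    refine wp_seq (wp_rd C (by omega) (by omega) (by omega) (by rw [h16, hP.snd]; omega)
      fun s₁ C₁ A₁ V₁ R₁ => ?_)
    rw [h16, hP.snd] at V₁
    have h16₁ := R₁ 16 (by omega) (by omega)
    refine wp_seq (wp_rd C₁ (by omega) (by omega) (by omega)
      (by rw [V₁, A₁, hP.deg]; omega) fun s₂ C₂ A₂ V₂ R₂ => ?_)
    rw [V₁, A₁, hP.deg] at V₂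
    have h16₂ := R₂ 16 (by omega) (by omega)
    have hA : arr l s₂ = arr l s := by rw [A₂, A₁]
    -- The first pass permutes the distinct edge numbers, so no item is pushed twice.
    have hni : i ∉ done := by
      have hnd := (tailSorted_perm d).nodup_iff.2 (List.nodup_finRange l.length)
      rw [tailSorted, htot] at hnd
      intro hc
      exact (List.nodup_append.1 hnd).2.2 i hc i (by simp) rfl
    refine wp_push (by omega) (by omega) (by omega) C₂ (by rwa [hA]) hni (by omega) V₂
      (headKey_lt hd i) fun s₄ C₄ B₄ A₄ R₄ => ⟨by omega, C₄, ?_, ?_, ?_, ?_, ?_, ?_, ?_, B₄⟩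
    · rw [R₄ 15 (by omega) (by omega), R₂ 15 (by omega) (by omega), R₁ 15 (by omega) (by omega)]
    · rw [R₄ 16 (by omega) (by omega)]
      omega
    · rw [A₄ 3 (by omega) (by omega), hA]
    · rw [A₄ 4 (by omega) (by omega), hA]
    · rwa [A₄ 0 (by omega) (by omega), hA]
    · rw [← hA] at hP
      exact hP.congr (A₄ 1 (by omega) (by omega)) (A₄ 7 (by omega) (by omega))
        (A₄ 8 (by omega) (by omega))
    · rwa [A₄ 2 (by omega) (by omega), hA]
  · have hl : (sortPass (width l) (tailKey l d) (List.finRange l.length)).length = l.length := by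
      rw [(sortPass_perm (tailKey_lt d) _).length_eq, List.length_finRange]
    rwa [hl] at ht

/-- The state of the greedy algorithm after the edges with numbers in `xs`. -/
def greedyState (l : List (Fin n × Fin n)) (d : Fin n → ℕ) (xs : List (Fin l.length)) :
    (Fin n → ℕ) × (Fin n → Fin n) :=
  (xs.map fun i => orient d (l.get i)).foldl (greedyStep d) (fun _ => 0, id)

theorem greedyState_append (d : Fin n → ℕ) (xs : List (Fin l.length)) (i : Fin l.length) :
    greedyState l d (xs ++ [i]) = greedyStep d (greedyState l d xs) (orient d (l.get i)) := by
  simp [greedyState]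

/-- Keeps the loads at most n, so that the sums formed by the program fit into a word. -/
theorem greedyStep_load_le {d : Fin n → ℕ} {σ : (Fin n → ℕ) × (Fin n → Fin n)}
    (h : ∀ v, σ.1 v ≤ d v) (e : Fin n × Fin n) (v : Fin n) : (greedyStep d σ e).1 v ≤ d v := by
  unfold greedyStep
  split_ifs with hc
  · simp only [Function.update_apply]
    split_ifs with h1 h2
    · rw [h1]
      exact hc.2
    · rw [h2]
    · exact h v
  · exact h v

/-- The greedy algorithm. -/
def runGreedy : Prog :=
  traverse 5 6 (.seq (rd 7 17 16) (.seq (rd 8 18 16) (.seq (rd 2 19 17) (.ite 0 19 .skip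
    (.seq (rd 1 20 17) (.seq (rd 2 21 18) (.seq (.add 21 21 20) (.seq (rd 1 22 18)
      (.ite 22 21 .skip (.seq (wr 2 17 20) (.seq (wr 2 18 21) (wr 0 17 18))))))))))))

theorem wp_runGreedy {d : Fin n → ℕ} (hd : ∀ v, d v ≤ n) (h : Ctx B l s)
    (h0 : ∀ v < n, arr l s 0 v = v) (hp : Prepared l d (arr l s)) (hz2 : arr l s 2 = 0)
    (hb : Buckets (headKey l d) (arr l s 5) (arr l s 6) (tailSorted l d))
    (hQ : ∀ t s', t ≤ l.length * 24 + width l * 5 + 2 →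
      (∀ v : Fin n, arr l s' 0 v = (greedyState l d (edgesSorted l d)).2 v) → Q t s') :
    WP B runGreedy s Q := by
  have h20 := h.bound
  have hw := width_eq (l := l)
  refine wp_traverse (by omega) (by omega) (τ := 21)
    (I := fun done A => Prepared l d A ∧ (∀ v, (greedyState l d done).1 v ≤ d v) ∧
      ∀ v : Fin n, A 2 v = (greedyState l d done).1 v ∧ A 0 v = (greedyState l d done).2 v)
    ?_ h hb ⟨hp, fun v => Nat.zero_le _, fun v => ⟨by rw [hz2]; rfl, h0 v v.2⟩⟩
    (fun t s' ht _ ⟨_, _, i3⟩ => hQ t s' ?_ fun v => (i3 v).2)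
  · rintro done i rest - s C h16 ⟨hP, hle, hI⟩
    have hle' := greedyStep_load_le hle (orient d (l.get i))
    rw [greedyState_append]
    obtain ⟨σ, hσ⟩ : ∃ σ, greedyState l d done = σ := ⟨_, rfl⟩
    rw [hσ] at hle hI hle' ⊢
    have hi := i.2
    have hf := hP.fst i
    have hs := hP.snd i
    obtain ⟨⟨u, v⟩, he⟩ : ∃ e, orient d (l.get i) = e := ⟨_, rfl⟩
    rw [he] at hle' hf hs ⊢
    simp only at hf hs
    have hu := u.2
    have hv := v.2
    have hdu := hd u
    have hdv := hd v
    have hlu := hle u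
    have hlv := hle v
    refine wp_seq (wp_rd C (by omega) (by omega) (by omega) (by rw [h16, hf]; omega)
      fun s₁ C₁ A₁ V₁ R₁ => ?_)
    rw [h16, hf] at V₁
    have h16₁ := R₁ 16 (by omega) (by omega)
    refine wp_seq (wp_rd C₁ (by omega) (by omega) (by omega)
      (by rw [h16₁, h16, A₁, hs]; omega) fun s₂ C₂ A₂ V₂ R₂ => ?_)
    rw [h16₁, h16, A₁, hs] at V₂
    have h17₂ := R₂ 17 (by omega) (by omega)
    rw [V₁] at h17₂
    refine wp_seq (wp_rd C₂ (by omega) (by omega) (by omega)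
      (by rw [h17₂, A₂, A₁, (hI u).1]; omega) fun s₃ C₃ A₃ V₃ R₃ => ?_)
    rw [h17₂, A₂, A₁, (hI u).1] at V₃
    have hA₃ : arr l s₃ = arr l s := by rw [A₃, A₂, A₁]
    have h15₃ : s₃.reg 15 = s.reg 15 := by
      rw [R₃ 15 (by omega) (by omega), R₂ 15 (by omega) (by omega), R₁ 15 (by omega) (by omega)]
    have h16₃ : s₃.reg 16 = s.reg 16 := by
      rw [R₃ 16 (by omega) (by omega), R₂ 16 (by omega) (by omega), h16₁]
    have h17₃ : s₃.reg 17 = u := by rw [R₃ 17 (by omega) (by omega), h17₂]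
    have h18₃ : s₃.reg 18 = v := by rw [R₃ 18 (by omega) (by omega), V₂]
    have hz := C₃.zero
    -- Register 0 holds 0, so the test asks whether the tail is already in use.
    refine wp_ite (fun hlt => wp_skip ?_) (fun hlt => ?_)
    · have hrej : greedyStep d σ (u, v) = σ := by
        refine if_neg fun hc => ?_
        have := hc.1
        simp only at this
        omega
      rw [hrej]
      exact ⟨by omega, C₃, h15₃, h16₃, by rw [hA₃], by rw [hA₃], by rwa [hA₃],
        hle, by rwa [hA₃]⟩
    have hl0 : σ.1 u = 0 := by omega
    refine wp_seq (wp_rd C₃ (by omega) (by omega) (by omega)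
      (by rw [h17₃, hA₃, hP.deg]; omega) fun s₄ C₄ A₄ V₄ R₄ => ?_)
    rw [h17₃, hA₃, hP.deg] at V₄
    have h18₄ := R₄ 18 (by omega) (by omega)
    rw [h18₃] at h18₄
    refine wp_seq (wp_rd C₄ (by omega) (by omega) (by omega)
      (by rw [h18₄, A₄, hA₃, (hI v).1]; omega) fun s₅ C₅ A₅ V₅ R₅ => ?_)
    rw [h18₄, A₄, hA₃, (hI v).1] at V₅
    have h20₅ := R₅ 20 (by omega) (by omega)
    have h18₅ := R₅ 18 (by omega) (by omega)
    refine wp_seq (wp_add C₅ (by omega) (by omega) fun s₆ C₆ A₆ R₆ => ?_)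
    rw [V₅, h20₅, V₄] at R₆
    have h18₆ : s₆.reg 18 = v := by rw [R₆, Function.update_of_ne (by omega), h18₅, h18₄]
    have hA₆ : arr l s₆ = arr l s := by rw [A₆, A₅, A₄, hA₃]
    refine wp_seq (wp_rd C₆ (by omega) (by omega) (by omega)
      (by rw [h18₆, hA₆, hP.deg]; omega) fun s₇ C₇ A₇ V₇ R₇ => ?_)
    rw [h18₆, hA₆, hP.deg] at V₇
    have hA₇ : arr l s₇ = arr l s := by rw [A₇, hA₆]
    have hr₇ : ∀ a, a ≠ 14 → a ≠ 20 → a ≠ 21 → a ≠ 22 → s₇.reg a = s₃.reg a := by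
      intro a h1 h2 h3 h4
      rw [R₇ a h1 h4, R₆, Function.update_of_ne h3, R₅ a h1 h3, R₄ a h1 h2]
    have h21₇ : s₇.reg 21 = σ.1 v + d u := by
      rw [R₇ 21 (by omega) (by omega), R₆, Function.update_self]
    have h20₇ : s₇.reg 20 = d u := by
      rw [R₇ 20 (by omega) (by omega), R₆, Function.update_of_ne (by omega), h20₅, V₄]
    have h15₇ := hr₇ 15 (by omega) (by omega) (by omega) (by omega)
    have h16₇ := hr₇ 16 (by omega) (by omega) (by omega) (by omega)
    have h17₇ := hr₇ 17 (by omega) (by omega) (by omega) (by omega)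
    have h18₇ := hr₇ 18 (by omega) (by omega) (by omega) (by omega)
    refine wp_ite (fun hlt => wp_skip ?_) (fun hlt => ?_)
    · have hrej : greedyStep d σ (u, v) = σ := by
        refine if_neg fun hc => ?_
        have := hc.2
        simp only at this
        omega
      rw [hrej]
      exact ⟨by omega, C₇, by omega, by omega, by rw [hA₇], by rw [hA₇], by rwa [hA₇],
        hle, by rwa [hA₇]⟩
    have hacc : greedyStep d σ (u, v) = (Function.update (Function.update σ.1 u (d u)) v
        (σ.1 v + d u), Function.update σ.2 u v) := if_pos ⟨hl0, by simp only; omega⟩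
    rw [hacc] at hle' ⊢
    refine wp_seq (wp_wr C₇ (by omega) (by omega) (by omega) (by omega) fun s₈ C₈ A₈ R₈ => ?_)
    have h17₈ := R₈ 17 (by omega)
    have h18₈ := R₈ 18 (by omega)
    have h21₈ := R₈ 21 (by omega)
    refine wp_seq (wp_wr C₈ (by omega) (by omega) (by omega) (by omega) fun s₉ C₉ A₉ R₉ => ?_)
    have h17₉ := R₉ 17 (by omega)
    have h18₉ := R₉ 18 (by omega)
    refine wp_wr C₉ (by omega) (by omega) (by omega) (by omega) fun s' C' A' R' => ?_
    have hr : ∀ r, r ≠ 0 → r ≠ 2 → arr l s' r = arr l s r := by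
      intro r h1 h2
      rw [A', upd_of_ne _ _ _ h1, A₉, upd_of_ne _ _ _ h2, A₈, upd_of_ne _ _ _ h2, hA₇]
    have e0 : arr l s' 0 = Function.update (arr l s 0) u v := by
      rw [A', upd_self, A₉, upd_of_ne _ _ _ (by omega), A₈, upd_of_ne _ _ _ (by omega), hA₇,
        h17₉, h17₈, h17₇, h17₃, h18₉, h18₈, h18₇, h18₃]
    have e2 : arr l s' 2 =
        Function.update (Function.update (arr l s 2) u (d u)) v (σ.1 v + d u) := by
      rw [A', upd_of_ne _ _ _ (by omega), A₉, upd_self, A₈, upd_self, hA₇, h17₇, h17₃, h18₈,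
        h18₇, h18₃, h21₈, h21₇, h20₇]
    refine ⟨by omega, C', ?_, ?_, hr 5 (by omega) (by omega), hr 6 (by omega) (by omega),
      hP.congr (hr 1 (by omega) (by omega)) (hr 7 (by omega) (by omega))
        (hr 8 (by omega) (by omega)), hle', fun w => ?_⟩
    · rw [R' 15 (by omega), R₉ 15 (by omega), R₈ 15 (by omega), h15₇, h15₃]
    · rw [R' 16 (by omega), R₉ 16 (by omega), R₈ 16 (by omega), h16₇, h16₃]
    · rw [e0, e2]
      simp only [Function.update_apply, Fin.val_inj]
      constructor
      · split_ifs
        · rfl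
        · rfl
        · exact (hI w).1
      · split_ifs
        · rfl
        · exact (hI w).2
  · have hl : (sortPass (width l) (headKey l d) (tailSorted l d)).length = l.length := by
      have := (edgesSorted_perm (l := l) hd).length_eq
      rwa [List.length_finRange] at this
    rwa [hl] at ht

/-- The whole algorithm. -/
def starClustering : Prog :=
  .seq setup (.seq initLabels (.seq countDegrees (.seq orientEdges (.seq bucketTails
    (.seq bucketHeads runGreedy)))))

theorem wp_starClustering (hB : 20 * width l ≤ B) (hd : ∀ v, endpointCount l v ≤ n)
    (hQ : ∀ t s, t ≤ 200 * width l →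
      (∀ v : Fin n, s.mem (2 + 2 * l.length + v) =
        ((greedyState l (endpointCount l) (edgesSorted l (endpointCount l))).2 v : ℕ)) →
      Q t s) :
    WP B starClustering (inputState l) Q := by
  have hw := width_eq (l := l)
  refine wp_seq (wp_setup hB fun s₁ C₁ Z₁ => ?_)
  refine wp_seq (wp_initLabels C₁ Z₁ fun t₂ s₂ T₂ C₂ L₂ Z₂ => ?_)
  refine wp_seq (wp_countDegrees C₂ L₂ Z₂ fun t₃ s₃ T₃ C₃ L₃ D₃ Z₃ => ?_)
  refine wp_seq (wp_orientEdges hd C₃ L₃ D₃ Z₃ fun t₄ s₄ T₄ C₄ L₄ P₄ Z₄ => ?_)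
  refine wp_seq (wp_bucketTails hd C₄ L₄ P₄ Z₄ fun t₅ s₅ T₅ C₅ L₅ P₅ Z₅ Y₅ B₅ => ?_)
  refine wp_seq (wp_bucketHeads hd C₅ L₅ P₅ Z₅ Y₅ B₅ fun t₆ s₆ T₆ C₆ L₆ P₆ Z₆ B₆ => ?_)
  refine wp_runGreedy hd C₆ L₆ P₆ Z₆ B₆ fun t₇ s₇ T₇ L₇ => hQ _ _ (by omega) fun v => ?_
  -- Array 0 holds the labels and begins directly behind the input, where the output is read.
  rw [← L₇, arr, if_pos ⟨by omega, by omega⟩, cell, zero_mul, add_zero]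

end Sorting

/-! ### Edge lists and degrees. -/

theorem ListsEdges.adj {V : Type*} {G : SimpleGraph V} {l : List (V × V)} (h : ListsEdges G l)
    {e : V × V} (he : e ∈ l) : G.Adj e.1 e.2 :=
  (h.2 s(e.1, e.2)).1 (List.mem_map_of_mem he)

section EdgeLists

variable {n : ℕ} {G : SimpleGraph (Fin n)} [DecidableRel G.Adj] {l : List (Fin n × Fin n)}

theorem ListsEdges.edgeFinset_eq (h : ListsEdges G l) :
    G.edgeFinset = (l.map fun e => s(e.1, e.2)).toFinset := by
  ext e
  rw [SimpleGraph.mem_edgeFinset, List.mem_toFinset, h.2]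

theorem ListsEdges.card_edgeFinset (h : ListsEdges G l) : #G.edgeFinset = l.length := by
  rw [h.edgeFinset_eq, List.toFinset_card_of_nodup h.1, List.length_map]

/-- Without loops, v cannot be both endpoints of an entry, so each entry counts at most once. -/
theorem endpointCount_eq_countP (hl : ∀ e ∈ l, e.1 ≠ e.2) (v : Fin n) :
    endpointCount l v = (l.map fun e => s(e.1, e.2)).countP (v ∈ ·) := by
  induction l with
  | nil => rfl
  | cons e l ih =>
    have h1 := hl e (by simp)
    have h2 := ih fun e' he' => hl e' (by simp [he'])
    unfold endpointCount at h2 ⊢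
    simp only [List.map_cons, List.count_cons, List.countP_cons, ← h2, Sym2.mem_iff, beq_iff_eq,
      decide_eq_true_eq, eq_comm (a := v)]
    by_cases h3 : e.1 = v
    · have h4 : e.2 ≠ v := fun hc => h1 (h3.trans hc.symm)
      simp [h3, h4]
      omega
    · by_cases h4 : e.2 = v
      · simp [h3, h4]
        omega
      · simp [h3, h4]

theorem ListsEdges.endpointCount_eq (h : ListsEdges G l) (v : Fin n) :
    endpointCount l v = G.degree v := by
  rw [endpointCount_eq_countP fun e he => (h.adj he).ne, ← G.card_incidenceFinset_eq_degree,
    G.incidenceFinset_eq_filter, h.edgeFinset_eq, List.countP_eq_length_filter,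
    ← List.toFinset_card_of_nodup (h.1.filter _), List.toFinset_filter]
  simp

end EdgeLists

end NormMod

theorem mainTheorem2 :
    ∃ (T α : ℝ) (c : ℕ) (p : NormMod.Prog), 0 < α ∧ α ≤ 1 ∧
      ∀ (n : ℕ) (G : SimpleGraph (Fin n)) [DecidableRel G.Adj] (l : List (Fin n × Fin n)),
        (∀ v, 0 < G.degree v) → NormMod.ListsEdges G l →
        ∃ (t : ℕ) (s : NormMod.State),
          NormMod.Exec (c * (n + G.edgeFinset.card + 1)) p (NormMod.inputState l) t s ∧
          t ≤ c * (n + G.edgeFinset.card + 1) ∧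
          ((∃ P : NormMod.Clustering (Fin n), NormMod.nCut G P ≤ (P.parts.card : ℝ) - T) →
            NormMod.IsApproxClustering (NormMod.nMod G) α
              (NormMod.outputClustering n G.edgeFinset.card s)) := by
  -- T and α come from `isApproxClustering_of_greedyInv`. The 200 generously covers the steps of all
  -- phases as well as the words, for which 20 times the array width suffices.
  refine ⟨48, 1 / 12, 200, NormMod.starClustering, by norm_num, by norm_num, ?_⟩
  intro n G _ l hG hl
  have hdeg : NormMod.endpointCount l = fun v => G.degree v := funext hl.endpointCount_eq
  have hd : ∀ v, NormMod.endpointCount l v ≤ n := by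
    intro v
    rw [hdeg]
    simpa using (G.degree_lt_card_verts v).le
  rw [hl.card_edgeFinset]
  refine NormMod.wp_starClustering (Q := fun t s => _ ∧ _)
    (Nat.mul_le_mul_right _ (by norm_num)) hd fun t s ht hs => ⟨ht, fun hP => ?_⟩
  rw [hdeg] at hs hd
  have horient : ∀ e ∈ l, G.Adj (NormMod.orient (fun v => G.degree v) e).1
      (NormMod.orient (fun v => G.degree v) e).2 := by
    intro e he
    unfold NormMod.orient
    split_ifs
    · exact (hl.adj he).symm
    · exact hl.adj he
  have hadj : ∀ e ∈ (NormMod.edgesSorted l fun v => G.degree v).map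
      (fun i => NormMod.orient (fun v => G.degree v) (l.get i)), G.Adj e.1 e.2 := by
    intro e he
    obtain ⟨i, -, rfl⟩ := List.mem_map.1 he
    exact horient _ (List.get_mem _ _)
  refine NormMod.isApproxClustering_of_greedyInv G hG hadj ?_
    (NormMod.greedyInv_foldl hG (fun e he => ⟨(hadj e he).ne, ?_⟩)
      (NormMod.pairwise_edgesSorted hd)) ?_ hP
  · intro u v huv
    have h1 := (hl.2 s(u, v)).2 huv
    obtain ⟨e, he, heq⟩ := List.mem_map.1 h1
    obtain ⟨i, rfl⟩ := List.mem_iff_get.1 he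
    have h2 : NormMod.orient (fun v => G.degree v) (l.get i) ∈
        (NormMod.edgesSorted l fun v => G.degree v).map
          (fun i => NormMod.orient (fun v => G.degree v) (l.get i)) :=
      List.mem_map_of_mem ((NormMod.edgesSorted_perm hd).mem_iff.2 (List.mem_finRange i))
    have h3 : NormMod.orient (fun v => G.degree v) (l.get i) = (u, v) ∨
        NormMod.orient (fun v => G.degree v) (l.get i) = (v, u) := by
      rcases Sym2.eq_iff.1 heq with ⟨h, h'⟩ | ⟨h, h'⟩ <;> unfold NormMod.orient <;>
        split_ifs <;> simp only [Prod.ext_iff, Prod.fst_swap, Prod.snd_swap] <;> tauto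
    rcases h3 with h3 | h3 <;> rw [h3] at h2
    · exact Or.inl h2
    · exact Or.inr h2
  · obtain ⟨i, -, rfl⟩ := List.mem_map.1 he
    exact NormMod.orient_le (fun v => G.degree v) _
  -- The stored label of a vertex is the number of its star's center.
  · intro u v
    rw [hs, hs, Fin.val_inj]
    rfl
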